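/- Let $N\ge 1$ and let $\mathcal H^{N-1}$ be the Hausdorff measure of dimension $N-1$; "negligible" means $\mathcal H^{N-1}$-negligible. **Function spaces.** Let $V\subset\mathbb R^N$ be open and let $Z\subset\mathbb R^N$ be negligible. $C_{w,0}(V,Z)$ is the set of functions whose restriction to $V\setminus Z$ is continuous and which are locally bounded in $V$ out of $Z$ (each $x\in V$ has a ball $B\Subset V$ with $\sup_{B\setminus Z}|f|<\infty$). $DC_0(V,Z)$ is the set of functions that are locally in $V$ a difference of two semiconcave functions and whose gradient exists on $V\setminus Z$ and has components in $C_{w,0}(V,Z)$. $BV_{loc}(V)$ is the usual space. $\mathcal{GM}(V)$ is the set of real Radon measures on $V$ (of finite total variation on compact subsets of $V$) that vanish on negligible sets. **Manifold.** Let $X$ be a $DC_0$ Riemannian manifold of dimension $N$: a Hausdorff $\sigma$-compact space with charts $\phi_\alpha:U_\alpha\to\mathbb R^N$ ($\alpha\in\Lambda$) that cover it (homeomorphisms of open sets onto open sets) and a set $\mathcal S\subset X$ such that every $\mathcal S_\alpha:=\phi_\alpha(U_\alpha\cap\mathcal S)$ is negligible and every transition map $F=\phi_\beta\circ\phi_\alpha^{-1}$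 has components in $DC_0(\phi_\alpha(U_\alpha\cap U_\beta),\mathcal S_\alpha)$; and a Riemannian metric $g$ on $X\setminus\mathcal S$, given in each chart by a symmetric matrix $G_\alpha=(g_{ij})$ with entries in $BV_{loc}(\phi_\alpha(U_\alpha))\cap C_{w,0}(\phi_\alpha(U_\alpha),\mathcal S_\alpha)$, with $c(x)\|v\|^2\le\sum_{i,j} g_{ij}(x)v_iv_j\le c(x)^{-1}\|v\|^2$ for all $v\in\mathbb R^N$ and $x\in\phi_\alpha(U_\alpha\setminus\mathcal S)$, where $c>0$ and $c,c^{-1}$ are locally bounded in $\phi_\alpha(U_\alpha)$, and with the usual transformation rule of covariant $2$-tensors out of $\mathcal S$. **Tensors.** For a transition map $F$ and a measure $\mu$ put $F^*\mu=(F^{-1})_\sharp(|\det dF^{-1}|\,\mu)$. Let $\Omega\subset X$ be open and $p\ge0$. A covariant $p$-tensor $S$ on $\Omega$ with $\mathcal{GM}$ components consists, for every $\alpha$, of measures $S_{\alpha,j}\in\mathcal{GM}(\phi_\alpha(U_\alpha\cap\Omega))$, $j\in\{1,\dots,N\}^p$, such that for all $\alpha,\beta$ and all $i\in\{1,\dots,N\}^p$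 $$S_{\alpha,i}=\sum_{j}\frac{\partial F_{j_1}}{\partial x_{i_1}}\cdots\frac{\partial F_{j_p}}{\partial x_{i_p}}\,F^*(S_{\beta,j})\quad\text{in }\phi_\alpha(U_\alpha\cap U_\beta\cap\Omega),\qquad F=\phi_\beta\circ\phi_\alpha^{-1}.$$ An orthonormal frame in the chart $\alpha$ is a family $E=(E_1,\dots,E_N)$ of vector fields on $\phi_\alpha(U_\alpha\cap\Omega)$ with components in $C_{w,0}(\phi_\alpha(U_\alpha\cap\Omega),\mathcal S_\alpha)$ and $g(E_i,E_j)=\delta_{ij}$ out of $\mathcal S_\alpha$. Let $|S_\alpha|_g$ be the total variation (with respect to the Euclidean norm of $\mathbb R^{N^p}$) of the $\mathbb R^{N^p}$-valued Radon measure on $\phi_\alpha(U_\alpha\cap\Omega)$ with components $$S_\alpha(E_{i_1},\dots,E_{i_p})=\sum_{j}E_{i_1}^{j_1}\cdots E_{i_p}^{j_p}\,S_{\alpha,j},\qquad i\in\{1,\dots,N\}^p.$$ **Lemma.** For every covariant $p$-tensor $S$ on $\Omega$ with $\mathcal{GM}$ components, orthonormal frames exist in every chart, and $(|S_\alpha|_g)_{\alpha\in\Lambda}$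 is a system of $\mathcal{GM}$ measures: whatever frames are chosen in the charts, $|S_\alpha|_g\in\mathcal{GM}(\phi_\alpha(U_\alpha\cap\Omega))$ for all $\alpha$, and for all $\alpha,\beta$, with $F=\phi_\beta\circ\phi_\alpha^{-1}$, $$F^*(|S_\beta|_g)=|S_\alpha|_g\quad\text{in }\phi_\alpha(U_\alpha\cap U_\beta\cap\Omega).$$ Thus it induces a measure: there is exactly one nonnegative measure $|S|_g\in\mathcal{GM}(\Omega)$ (a Radon measure on $\Omega$ whose image under every chart $\phi_\alpha$ belongs to $\mathcal{GM}(\phi_\alpha(U_\alpha\cap\Omega))$) such that, for every $\alpha$, every orthonormal frame in the chart $\alpha$ and every Borel set $B\subset U_\alpha\cap\Omega$, $$|S|_g(B)=\int_{\phi_\alpha(B)}\sqrt{\det G_\alpha(x)}\;d|S_\alpha|_g(x).$$ -/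

import Mathlib

open MeasureTheory Set
open scoped ContDiff

noncomputable section

/-- Euclidean space `ℝ^N`. -/
abbrev Euc (N : ℕ) := EuclideanSpace ℝ (Fin N)

/-- The `i`-th vector of the canonical basis of `ℝ^N`. -/
def stdVec {N : ℕ} (i : Fin N) : Euc N := EuclideanSpace.single i 1

/-- `A` is negligible for the Hausdorff measure of dimension `N - 1`. -/
def HNull {N : ℕ} (A : Set (Euc N)) : Prop := Measure.hausdorffMeasure ((N : ℝ) - 1) A = 0

/-! ### Function spaces on open subsets of `ℝ^N` -/

/-- `f` is locally bounded in `Ω` out of `S`: every point of `Ω` has a ball, relatively compact in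
`Ω`, on which `f` is bounded out of `S`. -/
def LocBddOff {N : ℕ} (Ω S : Set (Euc N)) (f : Euc N → ℝ) : Prop :=
  ∀ x ∈ Ω, ∃ r > 0, Metric.closedBall x r ⊆ Ω ∧ ∃ C : ℝ, ∀ y ∈ Metric.ball x r \ S, |f y| ≤ C

/-- The class `C_{w,0}(Ω, S)`: the exceptional set `S` is `H^{N-1}`-negligible, the restriction of
`f` to `Ω ∖ S` is continuous, and it is locally bounded in `Ω`. -/
structure IsCw0 {N : ℕ} (Ω S : Set (Euc N)) (f : Euc N → ℝ) : Prop where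
  null : HNull S
  cont : ContinuousOn f (Ω \ S)
  bdd : LocBddOff Ω S f

/-- `f` is semiconcave in the open set `Ω`: near each point of `Ω` it becomes concave after
subtracting some multiple of `‖y‖ ^ 2`. -/
def IsSemiconcave {N : ℕ} (Ω : Set (Euc N)) (f : Euc N → ℝ) : Prop :=
  ∀ x ∈ Ω, ∃ r > 0, Metric.ball x r ⊆ Ω ∧
    ∃ c : ℝ, ConcaveOn ℝ (Metric.ball x r) (fun y => f y - c * ‖y‖ ^ 2)

/-- `f` is DC in the open set `Ω`: it is locally a difference of two semiconcave functions. -/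
def IsDC {N : ℕ} (Ω : Set (Euc N)) (f : Euc N → ℝ) : Prop :=
  ∀ x ∈ Ω, ∃ V, IsOpen V ∧ x ∈ V ∧ V ⊆ Ω ∧
    ∃ u v : Euc N → ℝ, IsSemiconcave V u ∧ IsSemiconcave V v ∧ ∀ y ∈ V, f y = u y - v y

/-- The class `DC_0(Ω, S)`: DC functions whose gradient exists out of `S` and has components in
`C_{w,0}(Ω, S)`. (Existence of the gradient at all points of `Ω ∖ S` is automatic when the almost
everywhere defined gradient has an extension in `C_{w,0}(Ω, S)`.) -/
structure IsDC0 {N : ℕ} (Ω S : Set (Euc N)) (f : Euc N → ℝ) : Prop where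
  dc : IsDC Ω f
  diff : ∀ x ∈ Ω \ S, DifferentiableAt ℝ f x
  grad : ∀ i : Fin N, IsCw0 Ω S (fun x => fderiv ℝ f x (stdVec i))

/-- `BV(V)`: `f` is integrable on `V` and its distributional partial derivatives in `V` are finite
signed measures. -/
structure IsBV {N : ℕ} (V : Set (Euc N)) (f : Euc N → ℝ) : Prop where
  integrable : IntegrableOn f V
  deriv : ∀ i : Fin N, ∃ m : SignedMeasure (Euc N), ∀ ψ : Euc N → ℝ,
    ContDiff ℝ ∞ ψ → HasCompactSupport ψ → tsupport ψ ⊆ V →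
      ∫ x in V, f x * fderiv ℝ ψ x (stdVec i) = - ∫ᵛ x, ψ x ∂•m

/-- `BV_loc(V)`: `f` is `BV` on every open set that is relatively compact in `V`. -/
def IsBVLoc {N : ℕ} (V : Set (Euc N)) (f : Euc N → ℝ) : Prop :=
  ∀ V', IsOpen V' → IsCompact (closure V') → closure V' ⊆ V → IsBV V' f

/-! ### Real and vector valued Radon measures

A `W`-valued Radon measure `μ` on an open set `Ω` has finite total variation only on compact subsets
of `Ω`, and `μ(B)` makes sense only for Borel sets `B` contained in a compact subset of `Ω`. It is
encoded by the finite measures `μ K = μ(· ∩ K)`, one for every compact set `K ⊆ Ω`; the values at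
all other sets `K` are irrelevant. -/

/-- The data of a Radon measure: a family of finite vector measures, indexed by sets. -/
abbrev RadonFamily (N : ℕ) (W : Type*) [AddCommMonoid W] [TopologicalSpace W] :=
  Set (Euc N) → VectorMeasure (Euc N) W

section RadonFamily

variable {N : ℕ}

/-- The family `μ` is a Radon measure on `Ω`: whenever `K ⊆ L` are compact subsets of `Ω`, the
measure `μ K` is the restriction to `K` of `μ L`. (With `K = L`: `μ K` is concentrated on `K`.) -/
def IsRadon {W : Type*} [AddCommMonoid W] [TopologicalSpace W]
    (Ω : Set (Euc N)) (μ : RadonFamily N W) : Prop :=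
  ∀ K L, IsCompact K → IsCompact L → K ⊆ L → L ⊆ Ω → μ K = (μ L).restrict K

/-- Equality of Radon measures in the set `Ω`. -/
def EqIn {W : Type*} [AddCommMonoid W] [TopologicalSpace W]
    (Ω : Set (Euc N)) (μ ν : RadonFamily N W) : Prop :=
  ∀ K, IsCompact K → K ⊆ Ω → μ K = ν K

/-- The class `GM(Ω)`: real Radon measures on `Ω` that vanish on `H^{N-1}`-negligible sets. -/
structure IsGM (Ω : Set (Euc N)) (μ : RadonFamily N ℝ) : Prop where
  radon : IsRadon Ω μ
  vanish : ∀ K, IsCompact K → K ⊆ Ω → ∀ B, MeasurableSet B → HNull B → μ K B = 0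

/-- The class `GM(Ω)` for nonnegative measures: such a measure on `Ω` is seen as a measure on `ℝ^N`
which is concentrated on `Ω`. -/
structure IsPosGM (Ω : Set (Euc N)) (μ : Measure (Euc N)) : Prop where
  finite : ∀ K, IsCompact K → K ⊆ Ω → μ K < ⊤
  conc : μ Ωᶜ = 0
  vanish : ∀ B ⊆ Ω, HNull B → μ B = 0

/-- The product `h μ`, that is `(h μ)(B) = ∫_B h dμ`. -/
def RadonFamily.density (h : Euc N → ℝ) (μ : RadonFamily N ℝ) : RadonFamily N ℝ :=
  fun K => (μ K).withDensity h (ContinuousLinearMap.lsmul ℝ ℝ)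

/-- The vector valued measure with components `μ i`. -/
def RadonFamily.pi {ι : Type*} [Fintype ι] [DecidableEq ι] (μ : ι → RadonFamily N ℝ) :
    RadonFamily N (EuclideanSpace ℝ ι) :=
  fun K => ∑ i, (μ i K).mapRange
    (LinearMap.toSpanSingleton ℝ (EuclideanSpace ℝ ι) (EuclideanSpace.single i 1)).toAddMonoidHom
    (by
      change Continuous fun t : ℝ => t • (EuclideanSpace.single i 1 : EuclideanSpace ℝ ι)
      fun_prop)

theorem RadonFamily.pi_apply {ι : Type*} [Fintype ι] [DecidableEq ι] (μ : ι → RadonFamily N ℝ)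
    (K B : Set (Euc N)) (i : ι) : RadonFamily.pi μ K B i = μ i K B := by
  have h : RadonFamily.pi μ K B =
      ∑ j, μ j K B • (EuclideanSpace.single j 1 : EuclideanSpace ℝ ι) := by
    simp only [RadonFamily.pi, FunLike.coe_sum, Finset.sum_apply]
    rfl
  rw [h]
  simp [Pi.single_apply]

/-- The total variation `|μ|` in `Ω` of a vector valued Radon measure, a measure on `ℝ^N` which is
concentrated on `Ω`: the supremum of the total variations `|μ(· ∩ K)|` over compact `K ⊆ Ω`. -/
def RadonFamily.totalVariation {W : Type*} [NormedAddCommGroup W]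
    (Ω : Set (Euc N)) (μ : RadonFamily N W) : Measure (Euc N) :=
  ⨆ K : {K : Set (Euc N) // IsCompact K ∧ K ⊆ Ω}, (μ K.1).variation

/-! ### Pull-backs -/

/-- The partial derivative `∂F_j/∂x_i`. -/
def pd (F : Euc N → Euc N) (j i : Fin N) (x : Euc N) : ℝ :=
  fderiv ℝ (fun y => F y j) x (stdVec i)

/-- `|det dF⁻¹|`, as a function on the target of `F`. -/
def absJacSymm (F : OpenPartialHomeomorph (Euc N) (Euc N)) (y : Euc N) : ℝ :=
  |(fderiv ℝ F.symm y).det|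

/-- The pull-back `F^* μ = (F⁻¹)_♯ (|det dF⁻¹| μ)` of a real Radon measure. The map `F⁻¹` is
extended by zero out of the target of `F`, which makes it a Borel map. -/
def RadonFamily.pullback (F : OpenPartialHomeomorph (Euc N) (Euc N)) (μ : RadonFamily N ℝ) :
    RadonFamily N ℝ :=
  fun K => (RadonFamily.density (absJacSymm F) μ (F '' K)).map (F.target.indicator F.symm)

/-- The pull-back `(F⁻¹)_♯ (|det dF⁻¹| μ)` of the restriction of a nonnegative measure `μ` to a
subset `A` of the target of `F`. -/
def pullbackPos (F : OpenPartialHomeomorph (Euc N) (Euc N)) (A : Set (Euc N))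
    (μ : Measure (Euc N)) : Measure (Euc N) :=
  ((μ.restrict A).withDensity (fun y => ENNReal.ofReal (absJacSymm F y))).map F.symm

/-- The components of the pull-back of a covariant `p`-tensor with measure components:
`(F^* S)_i = ∑_j (∂F_{j_1}/∂x_{i_1}) ⋯ (∂F_{j_p}/∂x_{i_p}) F^*(S_j)`. -/
def pullbackTensor {p : ℕ} (F : OpenPartialHomeomorph (Euc N) (Euc N))
    (S : (Fin p → Fin N) → RadonFamily N ℝ) (i : Fin p → Fin N) : RadonFamily N ℝ :=
  ∑ j : Fin p → Fin N,
    RadonFamily.density (fun x => ∏ k, pd F (j k) (i k) x) (RadonFamily.pullback F (S j))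

end RadonFamily

/-! ### `DC_0` Riemannian manifolds -/

/-- A `DC_0` Riemannian manifold of dimension `N`, with atlas indexed by `Λ`. The atlas is not
required to be maximal, so that maximal atlases are a particular case. -/
structure DC0Manifold (N : ℕ) (X : Type*) [TopologicalSpace X] [T2Space X] [SigmaCompactSpace X]
    (Λ : Type*) where
  /-- The charts `φ_α : U_α → ℝ^N`, homeomorphisms onto open subsets of `ℝ^N`. -/
  chart : Λ → OpenPartialHomeomorph X (Euc N)
  cover : ∀ x, ∃ α, x ∈ (chart α).source
  /-- The singular set. -/
  sing : Set X
  sing_null : ∀ α, HNull (chart α '' ((chart α).source ∩ sing))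
  /-- The transition maps `φ_β ∘ φ_α⁻¹`, defined on `φ_α(U_α ∩ U_β)`, are `DC_0`. -/
  transition_dc0 : ∀ α β (j : Fin N),
    IsDC0 ((chart α).symm.trans (chart β)).source (chart α '' ((chart α).source ∩ sing))
      (fun x => ((chart α).symm.trans (chart β)) x j)
  /-- The components of the metric in the charts; they are meaningful out of the singular set. -/
  g : Λ → Euc N → Matrix (Fin N) (Fin N) ℝ
  g_symm : ∀ α, ∀ x ∈ chart α '' ((chart α).source \ sing), (g α x).IsSymm
  g_bv : ∀ α i j, IsBVLoc (chart α).target (fun x => g α x i j)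
  g_cw0 : ∀ α i j, IsCw0 (chart α).target (chart α '' ((chart α).source ∩ sing))
    (fun x => g α x i j)
  /-- Local ellipticity: `c⁻¹ ‖v‖ ^ 2 ≥ ∑ g_{ij} v_i v_j ≥ c ‖v‖ ^ 2`, with `c > 0` such that `c`
  and `c⁻¹` are locally bounded. -/
  g_elliptic : ∀ α, ∃ c : Euc N → ℝ, (∀ x ∈ (chart α).target, 0 < c x) ∧
    LocBddOff (chart α).target ∅ c ∧ LocBddOff (chart α).target ∅ (fun x => (c x)⁻¹) ∧
    ∀ x ∈ chart α '' ((chart α).source \ sing), ∀ v : Euc N,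
      ∑ i, ∑ j, g α x i j * v i * v j ≤ (c x)⁻¹ * ‖v‖ ^ 2 ∧
      c x * ‖v‖ ^ 2 ≤ ∑ i, ∑ j, g α x i j * v i * v j
  /-- The metric is a covariant 2-tensor on the complement of the singular set. -/
  g_compat : ∀ α β,
    ∀ x ∈ chart α '' (((chart α).source ∩ (chart β).source) \ sing), ∀ i j,
      g α x i j = ∑ k, ∑ l,
        pd ((chart α).symm.trans (chart β)) k i x * pd ((chart α).symm.trans (chart β)) l j x *
          g β (((chart α).symm.trans (chart β)) x) k l

namespace DC0Manifold

variable {N : ℕ} {X : Type*} [TopologicalSpace X] [T2Space X] [SigmaCompactSpace X] {Λ : Type*}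
  (M : DC0Manifold N X Λ)

/-- The transition map `F = φ_β ∘ φ_α⁻¹ : φ_α(U_α ∩ U_β) → φ_β(U_α ∩ U_β)`. -/
def transition (α β : Λ) : OpenPartialHomeomorph (Euc N) (Euc N) :=
  (M.chart α).symm.trans (M.chart β)

/-- The set `φ_α(U_α ∩ A)`. -/
def img (α : Λ) (A : Set X) : Set (Euc N) := M.chart α '' ((M.chart α).source ∩ A)

/-- The set `φ_α(U_α ∩ U_β ∩ A)`. -/
def overlap (α β : Λ) (A : Set X) : Set (Euc N) := M.img α ((M.chart β).source ∩ A)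

/-- Covariant `p`-tensors on `Ω` with `GM` components: for each chart, components
`S_{α, j_1 … j_p}` in `GM(φ_α(U_α ∩ Ω))`, with `F^* S_β = S_α` in `φ_α(U_α ∩ U_β ∩ Ω)`. -/
structure GMTensor (Ω : Set X) (p : ℕ) where
  comp : Λ → (Fin p → Fin N) → RadonFamily N ℝ
  isGM : ∀ α j, IsGM (M.img α Ω) (comp α j)
  compat : ∀ α β i,
    EqIn (M.overlap α β Ω) (pullbackTensor (M.transition α β) (comp β) i) (comp α i)

/-- `E = (E_1, …, E_N)` is a local orthonormal frame in `φ_α(U_α ∩ Ω)`: the components of the vector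
fields `E_i` belong to `C_{w,0}`, with exceptional set the image of the singular set, and out of
this set `g(E_i, E_j) = δ_{ij}`. Here `E i x k` is the `k`-th component of `E_i` at `x`. -/
structure IsFrame (Ω : Set X) (α : Λ) (E : Fin N → Euc N → Euc N) : Prop where
  cw0 : ∀ i k, IsCw0 (M.img α Ω) (M.img α M.sing) (fun x => E i x k)
  orthonormal : ∀ x ∈ M.img α Ω \ M.img α M.sing, ∀ i j,
    ∑ k, ∑ l, M.g α x k l * E i x k * E j x l = if i = j then 1 else 0

/-- `√(det G_α)`. -/
def sqrtDetG (α : Λ) (x : Euc N) : ℝ := Real.sqrt (M.g α x).det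

/-- A nonnegative measure on `X`, concentrated on `Ω`, belongs to `GM(Ω)`: it is a Radon measure on
`Ω`, and read in any chart it belongs to `GM(φ_α(U_α ∩ Ω))`. -/
structure IsPosGM [MeasurableSpace X] (Ω : Set X) (ν : Measure X) : Prop where
  finite : ∀ K, IsCompact K → K ⊆ Ω → ν K < ⊤
  conc : ν Ωᶜ = 0
  read : ∀ α, _root_.IsPosGM (M.img α Ω)
    ((ν.restrict ((M.chart α).source ∩ Ω)).map (M.chart α))

variable {M}

/-- The evaluation `S_α(E_{i_1}, …, E_{i_p}) = ∑_j E_{i_1}^{j_1} ⋯ E_{i_p}^{j_p} S_{α, j}`. -/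
def GMTensor.eval {Ω : Set X} {p : ℕ} (S : M.GMTensor Ω p) (α : Λ)
    (E : Fin N → Euc N → Euc N) (i : Fin p → Fin N) : RadonFamily N ℝ :=
  ∑ j : Fin p → Fin N, RadonFamily.density (fun x => ∏ k, E (i k) x (j k)) (S.comp α j)

/-- The norm `|S_α|_g` of `S` in the chart `α`, computed in the frame `E`: the total variation in
`φ_α(U_α ∩ Ω)` of the `ℝ^{N^p}`-valued measure with components `S_α(E_{i_1}, …, E_{i_p})`. -/
def GMTensor.localNorm {Ω : Set X} {p : ℕ} (S : M.GMTensor Ω p) (α : Λ)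
    (E : Fin N → Euc N → Euc N) : Measure (Euc N) :=
  RadonFamily.totalVariation (M.img α Ω) (RadonFamily.pi (S.eval α E))

end DC0Manifold

end

/-! ### The class `C_{w,0}` -/

/-! The measures are turned into functions, so that the invariance becomes pointwise linear algebra.
On a compact subset of a chart, finitely many components have densities `f j` against one finite
positive measure `lam` (the sum of their variations), and `lam` does not charge negligible sets.
Functions of class `C_{w,0}` are then bounded and measurable up to a `lam`-null set, so every
product in the definitions acts on densities (`RadonFamily.density_eq`). If `A` is the matrix of a
frame, the evaluated tensor has density `A^{⊗p} f`, and its total variation is `|A^{⊗p} f| lam`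
(`variation_eval`).

Orthonormality reads `A G Aᵀ = 1`, hence `Aᵀ A = G⁻¹`, and `|A^{⊗p} c|² = c · (Aᵀ A)^{⊗p} c` depends
only on `G`, not on the frame (`Matrix.norm_tensorPower_mulVec`). For a transition map with Jacobian
matrix `P`, the tensor law multiplies the density by `(Pᵀ)^{⊗p}` and by `|det dF⁻¹|`, while `A Pᵀ`
is orthonormal for the metric of the other chart. The norms therefore cancel and only `|det dF⁻¹|`
survives, which is the pull-back rule for `|S_α|_g` (`variation_eval_transition`,
`pullbackPos_localNorm`).

The weight `√(det G)` transforms by the same factor, so the weighted measures agree on chart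
overlaps. By σ-compactness countably many charts suffice, and the measures glue to a unique measure
on `Ω` (`existsUnique_measure`). Frames come from Gram-Schmidt: it preserves continuity, and
ellipticity bounds the result. -/

theorem HNull.exists_measurableSet_superset {N : ℕ} {A : Set (Euc N)} (hA : HNull A) :
    ∃ B, A ⊆ B ∧ MeasurableSet B ∧ HNull B := by
  obtain ⟨B, hAB, hB, h⟩ :=
    exists_measurable_superset (Measure.hausdorffMeasure ((N : ℝ) - 1) : Measure (Euc N)) A
  exact ⟨B, hAB, hB, h.trans hA⟩

namespace LocBddOff

variable {N : ℕ} {Ω S : Set (Euc N)} {f h : Euc N → ℝ}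

theorem map₂ (hf : LocBddOff Ω S f) (hh : LocBddOff Ω S h) {φ : ℝ → ℝ → ℝ} {Φ : ℝ → ℝ → ℝ}
    (hφ : ∀ a b A B, |a| ≤ A → |b| ≤ B → |φ a b| ≤ Φ A B) :
    LocBddOff Ω S (fun x => φ (f x) (h x)) := by
  intro x hx
  obtain ⟨r, hr, hrΩ, C, hC⟩ := hf x hx
  obtain ⟨s, hs, -, D, hD⟩ := hh x hx
  refine ⟨min r s, lt_min hr hs,
    (Metric.closedBall_subset_closedBall (min_le_left _ _)).trans hrΩ, Φ C D, fun y hy => ?_⟩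
  exact hφ _ _ _ _ (hC y ⟨Metric.ball_subset_ball (min_le_left _ _) hy.1, hy.2⟩)
    (hD y ⟨Metric.ball_subset_ball (min_le_right _ _) hy.1, hy.2⟩)

theorem mono_of_le (hf : LocBddOff Ω S f) {φ : ℝ → ℝ}
    (hle : ∀ y ∈ Ω \ S, ∀ C, |f y| ≤ C → |h y| ≤ φ C) : LocBddOff Ω S h := by
  intro x hx
  obtain ⟨r, hr, hrΩ, C, hC⟩ := hf x hx
  exact ⟨r, hr, hrΩ, φ C, fun y hy =>
    hle y ⟨hrΩ (Metric.ball_subset_closedBall hy.1), hy.2⟩ C (hC y hy)⟩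

theorem mono (hf : LocBddOff Ω S f) {Ω' S' : Set (Euc N)} (ho : IsOpen Ω') (hΩ : Ω' ⊆ Ω)
    (hS : S ⊆ S') : LocBddOff Ω' S' f := by
  intro x hx
  obtain ⟨r, hr, -, C, hC⟩ := hf x (hΩ hx)
  obtain ⟨s, hs, hsΩ⟩ := Metric.nhds_basis_closedBall.mem_iff.1 (ho.mem_nhds hx)
  exact ⟨min r s, lt_min hr hs,
    (Metric.closedBall_subset_closedBall (min_le_right _ _)).trans hsΩ, C, fun y hy =>
    hC y ⟨Metric.ball_subset_ball (min_le_left _ _) hy.1, fun h => hy.2 (hS h)⟩⟩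

theorem exists_bound_of_isCompact (hf : LocBddOff Ω S f) {K : Set (Euc N)} (hK : IsCompact K)
    (hKΩ : K ⊆ Ω) : ∃ C, ∀ x ∈ K \ S, |f x| ≤ C := by
  refine hK.induction_on (p := fun A => ∃ C, ∀ x ∈ A \ S, |f x| ≤ C) ⟨0, by simp⟩ ?_ ?_ ?_
  · rintro A B hAB ⟨C, hC⟩
    exact ⟨C, fun x hx => hC x ⟨hAB hx.1, hx.2⟩⟩
  · rintro A B ⟨C, hC⟩ ⟨D, hD⟩
    refine ⟨max C D, fun x hx => ?_⟩
    rcases hx.1 with h | h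
    · exact (hC x ⟨h, hx.2⟩).trans (le_max_left _ _)
    · exact (hD x ⟨h, hx.2⟩).trans (le_max_right _ _)
  · intro x hx
    obtain ⟨r, hr, -, C, hC⟩ := hf x (hKΩ hx)
    exact ⟨Metric.ball x r, mem_nhdsWithin_of_mem_nhds (Metric.ball_mem_nhds x hr), C, hC⟩

end LocBddOff

namespace IsCw0

variable {N : ℕ} {Ω S : Set (Euc N)} {f h : Euc N → ℝ}

theorem congr (hf : IsCw0 Ω S f) (h' : ∀ x ∈ Ω \ S, h x = f x) : IsCw0 Ω S h where
  null := hf.null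
  cont := hf.cont.congr h'
  bdd := hf.bdd.mono_of_le (φ := id) fun y hy C hC => by rw [h' y hy]; exact hC

theorem mono (hf : IsCw0 Ω S f) {Ω' : Set (Euc N)} (ho : IsOpen Ω') (hΩ : Ω' ⊆ Ω) :
    IsCw0 Ω' S f where
  null := hf.null
  cont := hf.cont.mono (sdiff_subset_sdiff_left hΩ)
  bdd := hf.bdd.mono ho hΩ subset_rfl

theorem const (hS : HNull S) (hΩ : IsOpen Ω) (c : ℝ) : IsCw0 Ω S (fun _ => c) where
  null := hS
  cont := continuousOn_const
  bdd x hx := by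
    obtain ⟨s, hs, hsΩ⟩ := Metric.nhds_basis_closedBall.mem_iff.1 (hΩ.mem_nhds hx)
    exact ⟨s, hs, hsΩ, |c|, fun _ _ => le_rfl⟩

theorem add (hf : IsCw0 Ω S f) (hh : IsCw0 Ω S h) : IsCw0 Ω S (fun x => f x + h x) where
  null := hf.null
  cont := hf.cont.add hh.cont
  bdd := hf.bdd.map₂ hh.bdd (φ := fun a b => a + b) (Φ := fun a b => a + b)
    fun a b _ _ ha hb => (abs_add_le a b).trans (add_le_add ha hb)

theorem mul (hf : IsCw0 Ω S f) (hh : IsCw0 Ω S h) : IsCw0 Ω S (fun x => f x * h x) where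
  null := hf.null
  cont := hf.cont.mul hh.cont
  bdd := hf.bdd.map₂ hh.bdd (φ := fun a b => a * b) (Φ := fun a b => a * b)
    fun a b A B ha hb => by
      rw [abs_mul]
      exact mul_le_mul ha hb (abs_nonneg b) ((abs_nonneg a).trans ha)

theorem abs (hf : IsCw0 Ω S f) : IsCw0 Ω S (fun x => |f x|) where
  null := hf.null
  cont := hf.cont.abs
  bdd := hf.bdd.mono_of_le (φ := id) fun y _ C hC => by rwa [abs_abs]

theorem sqrt (hf : IsCw0 Ω S f) : IsCw0 Ω S (fun x => √(f x)) where
  null := hf.null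
  cont := hf.cont.sqrt
  bdd := hf.bdd.mono_of_le (φ := fun C => √C) fun y _ C hC => by
    rw [abs_of_nonneg (Real.sqrt_nonneg _)]
    exact Real.sqrt_le_sqrt ((le_abs_self _).trans hC)

theorem sum (hS : HNull S) (hΩ : IsOpen Ω) {ι : Type*} {f : ι → Euc N → ℝ} (s : Finset ι)
    (hf : ∀ i ∈ s, IsCw0 Ω S (f i)) : IsCw0 Ω S (fun x => ∑ i ∈ s, f i x) := by
  classical
  induction s using Finset.induction_on with
  | empty => simpa using const hS hΩ 0
  | insert i s his ih =>
    simp only [Finset.sum_insert his]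
    exact (hf i (by simp)).add (ih fun j hj => hf j (by simp [hj]))

theorem prod (hS : HNull S) (hΩ : IsOpen Ω) {ι : Type*} {f : ι → Euc N → ℝ} (s : Finset ι)
    (hf : ∀ i ∈ s, IsCw0 Ω S (f i)) : IsCw0 Ω S (fun x => ∏ i ∈ s, f i x) := by
  classical
  induction s using Finset.induction_on with
  | empty => simpa using const hS hΩ 1
  | insert i s his ih =>
    simp only [Finset.prod_insert his]
    exact (hf i (by simp)).mul (ih fun j hj => hf j (by simp [hj]))

theorem det (hS : HNull S) (hΩ : IsOpen Ω) {n : ℕ} {A : Euc N → Matrix (Fin n) (Fin n) ℝ}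
    (hA : ∀ i j, IsCw0 Ω S (fun x => A x i j)) : IsCw0 Ω S (fun x => (A x).det) := by
  simp only [Matrix.det_apply']
  exact sum hS hΩ _ fun σ _ => (const hS hΩ _).mul (prod hS hΩ _ fun i _ => hA _ _)

/-- A function of class `C_{w,0}` is measurable up to a null set for every measure that is carried
by `Ω` and does not charge the exceptional set. -/
theorem aestronglyMeasurable (hf : IsCw0 Ω S f) (hΩ : MeasurableSet Ω) {μ : Measure (Euc N)}
    (hc : μ Ωᶜ = 0) (hS : μ S = 0) : AEStronglyMeasurable f μ := by
  -- `S` need not be Borel; its measurable hull is still null, and `f` stays continuous off the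
  -- hull.
  have hm : MeasurableSet (Ω \ toMeasurable μ S) := hΩ.diff (measurableSet_toMeasurable μ S)
  have hr : μ.restrict (Ω \ toMeasurable μ S) = μ := by
    refine Measure.restrict_eq_self_of_ae_mem ?_
    have h1 : ∀ᵐ x ∂μ, x ∈ Ω := hc
    have h2 : ∀ᵐ x ∂μ, x ∉ toMeasurable μ S := by
      rw [ae_iff]; simpa [measure_toMeasurable] using hS
    filter_upwards [h1, h2] with x hx hx' using ⟨hx, hx'⟩
  rw [← hr]
  exact (hf.cont.mono (sdiff_subset_sdiff_right (subset_toMeasurable μ S))).aestronglyMeasurable hm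

theorem exists_ae_bound (hf : IsCw0 Ω S f) {K : Set (Euc N)} (hK : IsCompact K) (hKΩ : K ⊆ Ω)
    {μ : Measure (Euc N)} (hc : μ Kᶜ = 0) (hS : μ S = 0) : ∃ C, ∀ᵐ x ∂μ, |f x| ≤ C := by
  obtain ⟨C, hC⟩ := hf.bdd.exists_bound_of_isCompact hK hKΩ
  have h1 : ∀ᵐ x ∂μ, x ∈ K := hc
  have h2 : ∀ᵐ x ∂μ, x ∉ S := by rw [ae_iff]; simpa using hS
  exact ⟨C, by filter_upwards [h1, h2] with x hx hx' using hC x ⟨hx, hx'⟩⟩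

end IsCw0

/-! ### Vector measures with a density -/

namespace MeasureTheory

variable {α β : Type*} [MeasurableSpace α] [MeasurableSpace β]

theorem SignedMeasure.isFiniteMeasure_variation (s : SignedMeasure α) :
    IsFiniteMeasure s.variation := by
  rw [← s.totalVariation_eq_variation]
  infer_instance

/-- Domination of the variation gives absolute continuity, and Radon-Nikodym applies. -/
theorem SignedMeasure.exists_density (s : SignedMeasure α) {lam : Measure α} [IsFiniteMeasure lam]
    (h : s.variation ≤ lam) : ∃ f, Integrable f lam ∧ s = lam.withDensityᵥ f := by
  refine ⟨s.rnDeriv lam, SignedMeasure.integrable_rnDeriv _ _, ?_⟩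
  refine (SignedMeasure.withDensityᵥ_rnDeriv_eq s lam ?_).symm
  refine VectorMeasure.AbsolutelyContinuous.mk fun B hB h0 => ?_
  rw [Measure.toENNRealVectorMeasure_apply_measurable hB] at h0
  have : ‖s B‖ₑ ≤ 0 := by
    rw [← h0]
    exact (s.enorm_measure_le_variation B).trans (h B)
  simpa using this

theorem Measure.withDensityᵥ_finsetSum {ι E : Type*} [NormedAddCommGroup E] [NormedSpace ℝ E]
    {lam : Measure α} (s : Finset ι) {f : ι → α → E} (hf : ∀ i ∈ s, Integrable (f i) lam) :
    ∑ i ∈ s, lam.withDensityᵥ (f i) = lam.withDensityᵥ (fun x => ∑ i ∈ s, f i x) := by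
  classical
  induction s using Finset.induction_on with
  | empty => exact (withDensityᵥ_zero (μ := lam) (E := E)).symm
  | insert i s his ih =>
    have h1 : ∀ j ∈ s, Integrable (f j) lam := fun j hj => hf j (by simp [hj])
    simp only [Finset.sum_insert his]
    rw [ih h1, withDensityᵥ_add' (hf i (by simp)) (integrable_finsetSum s h1)]

/-- Splitting `f` into positive and negative parts reduces integration against a signed measure to
two ordinary integrals. The bound on `h` makes all of them converge. -/
theorem Measure.withDensityᵥ_withDensity {lam : Measure α} {f h : α → ℝ} (hf : Integrable f lam)
    (hh : AEStronglyMeasurable h lam) {C : ℝ} (hC : ∀ᵐ x ∂lam, |h x| ≤ C) :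
    (lam.withDensityᵥ f).withDensity h (ContinuousLinearMap.lsmul ℝ ℝ) =
      lam.withDensityᵥ (fun x => h x * f x) := by
  have hhf : Integrable (fun x => h x * f x) lam := hf.bdd_mul hh hC
  have key : ∀ u : α → ℝ, Integrable u lam →
      IsFiniteMeasure (lam.withDensity fun x => ENNReal.ofReal (u x)) ∧
      AEStronglyMeasurable h (lam.withDensity fun x => ENNReal.ofReal (u x)) ∧
      (∀ᵐ x ∂(lam.withDensity fun x => ENNReal.ofReal (u x)), |h x| ≤ C) := fun u hu =>
    ⟨isFiniteMeasure_withDensity_ofReal hu.2, hh.mono_ac (withDensity_absolutelyContinuous _ _),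
      (withDensity_absolutelyContinuous _ _).ae_le hC⟩
  obtain ⟨i1, m1, b1⟩ := key f hf
  obtain ⟨i2, m2, b2⟩ := key (fun x => -f x) hf.neg
  have I1 : Integrable h (lam.withDensity fun x => ENNReal.ofReal (f x)) :=
    Integrable.of_bound m1 C b1
  have I2 : Integrable h (lam.withDensity fun x => ENNReal.ofReal (-f x)) :=
    Integrable.of_bound m2 C b2
  have hfl : (ContinuousLinearMap.lsmul ℝ ℝ : ℝ →L[ℝ] ℝ →L[ℝ] ℝ) =
      (ContinuousLinearMap.lsmul ℝ ℝ).flip := by ext; simp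
  have hd : VectorMeasure.Integrable (lam.withDensityᵥ f) h := by
    rw [VectorMeasure.Integrable, Measure.variation_withDensityᵥ hf]
    have : IsFiniteMeasure (lam.withDensity fun x => ‖f x‖ₑ) :=
      ⟨by simpa using! hf.2⟩
    exact Integrable.of_bound (hh.mono_ac (withDensity_absolutelyContinuous _ _)) C
      ((withDensity_absolutelyContinuous _ _).ae_le hC)
  have hp : ∀ u : α → ℝ, Integrable u lam →
      Integrable (fun x => (ENNReal.ofReal (u x)).toReal • h x) lam := fun u hu => by
    simp only [ENNReal.toReal_ofReal', smul_eq_mul]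
    exact hu.pos_part.mul_bdd hh hC
  ext B hB
  rw [VectorMeasure.withDensity_apply hd, withDensityᵥ_apply hhf hB,
    withDensityᵥ_eq_withDensity_pos_part_sub_withDensity_neg_part hf, VectorMeasure.restrict_sub,
    VectorMeasure.integral_sub_vectorMeasure, hfl, VectorMeasure.setIntegral_toSignedMeasure hB,
    VectorMeasure.setIntegral_toSignedMeasure hB,
    setIntegral_withDensity_eq_setIntegral_toReal_smul₀ _ _ _ hB,
    setIntegral_withDensity_eq_setIntegral_toReal_smul₀ _ _ _ hB, ← integral_sub]
  · refine integral_congr_ae (Filter.Eventually.of_forall fun x => ?_)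
    simp only [smul_eq_mul]
    rcases le_total 0 (f x) with h0 | h0
    · rw [ENNReal.toReal_ofReal h0, ENNReal.ofReal_of_nonpos (by linarith : -f x ≤ 0)]
      simp [mul_comm]
    · rw [ENNReal.toReal_ofReal (by linarith : 0 ≤ -f x), ENNReal.ofReal_of_nonpos h0]
      simp [mul_comm]
  · exact (hp f hf).integrableOn
  · exact (hp _ hf.neg).integrableOn
  · exact hf.neg.1.aemeasurable.ennreal_ofReal.restrict
  · exact Filter.Eventually.of_forall fun _ => ENNReal.ofReal_lt_top
  · exact hf.1.aemeasurable.ennreal_ofReal.restrict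
  · exact Filter.Eventually.of_forall fun _ => ENNReal.ofReal_lt_top
  · exact VectorMeasure.Integrable.restrict (by
      rwa [VectorMeasure.Integrable, Measure.variation_toSignedMeasure])
  · exact VectorMeasure.Integrable.restrict (by
      rwa [VectorMeasure.Integrable, Measure.variation_toSignedMeasure])

/-- `F` undoes `G` almost everywhere, so the density is carried along as `f ∘ F`. Pushing `lam.map
G` forward by `F` gives back `lam`, whence the measurability of `f ∘ F`. -/
theorem Measure.map_withDensityᵥ {E : Type*} [NormedAddCommGroup E] [NormedSpace ℝ E]
    {lam : Measure α} {G : α → β} {F : β → α} (hG : Measurable G) (hF : Measurable F)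
    (hFG : ∀ᵐ x ∂lam, F (G x) = x) {f : α → E} (hf : Integrable f lam) :
    Integrable (fun y => f (F y)) (lam.map G) ∧
      (lam.withDensityᵥ f).map G = (lam.map G).withDensityᵥ (fun y => f (F y)) := by
  have hmap : (lam.map G).map F = lam := by
    rw [Measure.map_map hF hG, Measure.map_congr (show F ∘ G =ᵐ[lam] id from hFG), Measure.map_id]
  have hm : AEStronglyMeasurable (fun y => f (F y)) (lam.map G) := by
    refine AEStronglyMeasurable.comp_measurable (f := F) ?_ hF
    rw [hmap]
    exact hf.1
  have hco : (fun x => f (F (G x))) =ᵐ[lam] f := by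
    filter_upwards [hFG] with x hx
    rw [hx]
  have hi : Integrable (fun y => f (F y)) (lam.map G) :=
    (integrable_map_measure hm hG.aemeasurable).2 (hf.congr hco.symm)
  refine ⟨hi, ?_⟩
  ext1 B hB
  rw [VectorMeasure.map_apply _ hG hB, withDensityᵥ_apply hf (hG hB), withDensityᵥ_apply hi hB,
    setIntegral_map hB hm hG.aemeasurable]
  exact integral_congr_ae (ae_restrict_of_ae hco.symm)

theorem Measure.map_withDensity_comp {lam : Measure α} {G : α → β} {F : β → α}
    (hG : Measurable G) (hF : Measurable F) (hFG : ∀ᵐ x ∂lam, F (G x) = x) {f : α → ENNReal}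
    (hf : AEMeasurable f lam) :
    (lam.withDensity f).map G = (lam.map G).withDensity (fun y => f (F y)) := by
  have hmap : (lam.map G).map F = lam := by
    rw [Measure.map_map hF hG, Measure.map_congr (show F ∘ G =ᵐ[lam] id from hFG), Measure.map_id]
  have hm : AEMeasurable (fun y => f (F y)) (lam.map G) := by
    refine AEMeasurable.comp_measurable (f := F) ?_ hF
    rw [hmap]
    exact hf
  ext B hB
  rw [Measure.map_apply hG hB, withDensity_apply _ (hG hB), withDensity_apply _ hB,
    Measure.restrict_map hG hB, lintegral_map' (by
      rw [← Measure.restrict_map hG hB]; exact hm.restrict) hG.aemeasurable]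
  refine lintegral_congr_ae (ae_restrict_of_ae ?_)
  filter_upwards [hFG] with x hx
  rw [hx]

end MeasureTheory

/-! ### Vector valued Radon families: densities and total variation -/

namespace RadonFamily

variable {N : ℕ}

theorem pi_eq_withDensityᵥ {ι : Type*} [Fintype ι] [DecidableEq ι] {μ : ι → RadonFamily N ℝ}
    {K : Set (Euc N)} {lam : Measure (Euc N)} {f : ι → Euc N → ℝ}
    (hf : ∀ i, Integrable (f i) lam) (hμ : ∀ i, μ i K = lam.withDensityᵥ (f i)) :
    Integrable (fun x => WithLp.toLp 2 fun i => f i x) lam ∧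
    RadonFamily.pi μ K =
      lam.withDensityᵥ (fun x => (WithLp.toLp 2 fun i => f i x : EuclideanSpace ℝ ι)) := by
  have hi : Integrable (fun x => (WithLp.toLp 2 fun i => f i x : EuclideanSpace ℝ ι)) lam := by
    have : (fun x => (WithLp.toLp 2 fun i => f i x : EuclideanSpace ℝ ι)) =
        fun x => ∑ i, f i x • (EuclideanSpace.single i 1 : EuclideanSpace ℝ ι) := by
      ext x i
      simp [Pi.single_apply]
    rw [this]
    exact integrable_finsetSum _ fun i _ => (hf i).smul_const _
  refine ⟨hi, ?_⟩
  ext1 B hB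
  rw [withDensityᵥ_apply hi hB]
  ext i
  rw [RadonFamily.pi_apply, hμ i, withDensityᵥ_apply (hf i) hB]
  exact (EuclideanSpace.proj i : EuclideanSpace ℝ ι →L[ℝ] ℝ).integral_comp_comm hi.integrableOn

theorem isRadon_pi {ι : Type*} [Fintype ι] [DecidableEq ι] {μ : ι → RadonFamily N ℝ}
    {Ω : Set (Euc N)} (hμ : ∀ i, IsRadon Ω (μ i)) : IsRadon Ω (RadonFamily.pi μ) := by
  intro K L hK hL hKL hLΩ
  ext1 B hB
  rw [VectorMeasure.restrict_apply _ hK.measurableSet hB]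
  ext i
  rw [RadonFamily.pi_apply, RadonFamily.pi_apply, hμ i K L hK hL hKL hLΩ,
    VectorMeasure.restrict_apply _ hK.measurableSet hB]

variable {W : Type*} [NormedAddCommGroup W] {Ω : Set (Euc N)} {μ : RadonFamily N W}

theorem variation_eq_restrict (hμ : IsRadon Ω μ) {K L : Set (Euc N)} (hK : IsCompact K)
    (hL : IsCompact L) (hKL : K ⊆ L) (hLΩ : L ⊆ Ω) :
    (μ K).variation = (μ L).variation.restrict K := by
  rw [hμ K L hK hL hKL hLΩ, VectorMeasure.variation_restrict hK.measurableSet]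

theorem variation_compl (hμ : IsRadon Ω μ) {K : Set (Euc N)} (hK : IsCompact K) (hKΩ : K ⊆ Ω) :
    (μ K).variation Kᶜ = 0 := by
  rw [variation_eq_restrict hμ hK hK subset_rfl hKΩ,
    Measure.restrict_apply hK.measurableSet.compl]
  simp

theorem variation_le_totalVariation {K : Set (Euc N)} (hK : IsCompact K) (hKΩ : K ⊆ Ω) :
    (μ K).variation ≤ μ.totalVariation Ω :=
  le_iSup (fun K : {K : Set (Euc N) // IsCompact K ∧ K ⊆ Ω} => (μ K.1).variation) ⟨K, hK, hKΩ⟩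

/-- Cut `|μ L|` along `K`. Inside `K` it is at most `|μ K|`, since both are restrictions of `|μ (K ∪
L)|`; outside it is at most the supremum restricted to `Kᶜ`. The resulting bound on the supremum,
once restricted to `K`, loses its second term. -/
theorem totalVariation_restrict (hμ : IsRadon Ω μ) {K : Set (Euc N)} (hK : IsCompact K)
    (hKΩ : K ⊆ Ω) : (μ.totalVariation Ω).restrict K = (μ K).variation := by
  have hle : μ.totalVariation Ω ≤ (μ K).variation + (μ.totalVariation Ω).restrict Kᶜ := by
    refine iSup_le fun L => ?_
    obtain ⟨L, hL, hLΩ⟩ := L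
    have hKL := hK.union hL
    have hKLΩ := union_subset hKΩ hLΩ
    calc (μ L).variation
        = (μ L).variation.restrict K + (μ L).variation.restrict Kᶜ :=
          (Measure.restrict_add_restrict_compl hK.measurableSet).symm
      _ ≤ (μ K).variation + (μ.totalVariation Ω).restrict Kᶜ := by
          refine add_le_add ?_ (Measure.restrict_mono subset_rfl
            (variation_le_totalVariation hL hLΩ))
          rw [variation_eq_restrict hμ hK hKL subset_union_left hKLΩ,
            variation_eq_restrict hμ hL hKL subset_union_right hKLΩ]
          exact Measure.restrict_mono subset_rfl Measure.restrict_le_self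
  refine le_antisymm ?_ ?_
  · refine (Measure.restrict_mono subset_rfl hle).trans ?_
    rw [Measure.restrict_add, Measure.restrict_restrict hK.measurableSet]
    simpa using Measure.restrict_le_self
  · rw [variation_eq_restrict hμ hK hK subset_rfl hKΩ]
    exact Measure.restrict_mono subset_rfl (variation_le_totalVariation hK hKΩ)

theorem totalVariation_compl (hΩ : MeasurableSet Ω) (hμ : IsRadon Ω μ) :
    μ.totalVariation Ω Ωᶜ = 0 := by
  have hle : μ.totalVariation Ω ≤ (μ.totalVariation Ω).restrict Ω := by
    refine iSup_le fun L => ?_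
    obtain ⟨L, hL, hLΩ⟩ := L
    have : (μ L).variation = (μ L).variation.restrict Ω := by
      refine (Measure.restrict_eq_self_of_ae_mem ?_).symm
      exact measure_mono_null (compl_subset_compl.2 hLΩ) (variation_compl hμ hL hLΩ)
    rw [this]
    exact Measure.restrict_mono subset_rfl (variation_le_totalVariation hL hLΩ)
  have := hle Ωᶜ
  rw [Measure.restrict_apply hΩ.compl] at this
  simpa using this

end RadonFamily

/-! ### Orthonormal frames -/

/-- The Gram-Schmidt process for a continuous family of inner products on `ℝ^N`. -/
theorem exists_continuousOn_orthonormal {Y : Type*} [TopologicalSpace Y] {T : Set Y} {N : ℕ}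
    {G : Y → Matrix (Fin N) (Fin N) ℝ} (hc : ∀ i j, ContinuousOn (fun y => G y i j) T)
    (hs : ∀ y ∈ T, (G y).IsSymm)
    (hpos : ∀ y ∈ T, ∀ v : Fin N → ℝ, v ≠ 0 → 0 < v ⬝ᵥ (G y).mulVec v) :
    ∃ E : ℕ → Y → Fin N → ℝ, (∀ i < N, ∀ k, ContinuousOn (fun y => E i y k) T) ∧
      ∀ y ∈ T, ∀ i < N, ∀ j < N, E i y ⬝ᵥ (G y).mulVec (E j y) = if i = j then 1 else 0 := by
  have hcd : ∀ u v : Y → Fin N → ℝ, (∀ k, ContinuousOn (fun y => u y k) T) →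
      (∀ k, ContinuousOn (fun y => v y k) T) →
      ContinuousOn (fun y => u y ⬝ᵥ (G y).mulVec (v y)) T := fun u v hu hv => by
    simp only [dotProduct, Matrix.mulVec]
    exact continuousOn_finsetSum _ fun i _ => (hu i).mul
      (continuousOn_finsetSum _ fun j _ => (hc i j).mul (hv j))
  have hsym : ∀ y ∈ T, ∀ u v, u ⬝ᵥ (G y).mulVec v = v ⬝ᵥ (G y).mulVec u := fun y hy u v => by
    rw [Matrix.dotProduct_mulVec, dotProduct_comm, ← Matrix.mulVec_transpose, hs y hy]
  -- The induction also carries triangularity: `E i` has no component beyond the `i`-th. It makes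
  -- the `n`-th component of the new vector `w` equal to 1, so `w` vanishes nowhere and can be
  -- normalized.
  suffices H : ∀ n ≤ N, ∃ E : ℕ → Y → Fin N → ℝ,
      (∀ i < n, ∀ k, ContinuousOn (fun y => E i y k) T) ∧
      (∀ y ∈ T, ∀ i < n, ∀ j < n, E i y ⬝ᵥ (G y).mulVec (E j y) = if i = j then 1 else 0) ∧
      ∀ i < n, ∀ y, ∀ k : Fin N, i < k → E i y k = 0 by
    obtain ⟨E, h1, h2, -⟩ := H N le_rfl
    exact ⟨E, h1, h2⟩
  intro n
  induction n with
  | zero => exact fun _ => ⟨0, by simp⟩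
  | succ n ih =>
    intro hn
    obtain ⟨E, h1, h2, h3⟩ := ih (by omega)
    let e : Fin N → ℝ := Pi.single ⟨n, hn⟩ 1
    let w : Y → Fin N → ℝ := fun y =>
      e - ∑ j ∈ Finset.range n, (e ⬝ᵥ (G y).mulVec (E j y)) • E j y
    have hw : ∀ k, ContinuousOn (fun y => w y k) T := fun k => by
      simp only [w, Pi.sub_apply, Finset.sum_apply, Pi.smul_apply, smul_eq_mul]
      exact continuousOn_const.sub (continuousOn_finsetSum _ fun j hj =>
        (hcd (fun _ => e) (E j) (fun _ => continuousOn_const) (h1 j (Finset.mem_range.1 hj))).mul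
          (h1 j (Finset.mem_range.1 hj) k))
    have hwk : ∀ y, ∀ k : Fin N, n < k → w y k = 0 := fun y k hk => by
      have hne : k ≠ ⟨n, hn⟩ := fun h => by simp [h] at hk
      simp only [w, Pi.sub_apply, Finset.sum_apply, Pi.smul_apply, smul_eq_mul, e,
        Pi.single_eq_of_ne hne, zero_sub, neg_eq_zero]
      refine Finset.sum_eq_zero fun j hj => ?_
      rw [h3 j (Finset.mem_range.1 hj) y k (by have := Finset.mem_range.1 hj; omega), mul_zero]
    have hw0 : ∀ y, w y ≠ 0 := fun y h => by
      have h' := congrFun h ⟨n, hn⟩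
      simp only [w, Pi.sub_apply, Finset.sum_apply, Pi.smul_apply, smul_eq_mul, e,
        Pi.single_eq_same, Pi.zero_apply] at h'
      rw [Finset.sum_eq_zero fun j hj => ?_] at h'
      · norm_num at h'
      · rw [h3 j (Finset.mem_range.1 hj) y ⟨n, hn⟩ (Finset.mem_range.1 hj), mul_zero]
    have hwE : ∀ y ∈ T, ∀ i < n, w y ⬝ᵥ (G y).mulVec (E i y) = 0 := fun y hy i hi => by
      simp only [w, sub_dotProduct, sum_dotProduct, smul_dotProduct, smul_eq_mul]
      rw [Finset.sum_congr rfl fun j hj => by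
        rw [h2 y hy j (Finset.mem_range.1 hj) i hi]]
      simp [hi]
    let q : Y → ℝ := fun y => w y ⬝ᵥ (G y).mulVec (w y)
    have hq : ∀ y ∈ T, 0 < q y := fun y hy => hpos y hy _ (hw0 y)
    refine ⟨Function.update E n fun y => (√(q y))⁻¹ • w y, ?_, ?_, ?_⟩
    · intro i hi k
      rcases eq_or_ne i n with rfl | hne
      · simp only [Function.update_self, Pi.smul_apply, smul_eq_mul]
        exact ((hcd w w hw hw).sqrt.inv₀ fun y hy => (Real.sqrt_pos.2 (hq y hy)).ne').mul (hw k)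
      · simp only [Function.update_of_ne hne]
        exact h1 i (by omega) k
    · intro y hy i hi j hj
      rcases eq_or_ne i n with hin | hin <;> rcases eq_or_ne j n with hjn | hjn
      · subst hin; subst hjn
        simp only [Function.update_self, Matrix.mulVec_smul, smul_dotProduct, dotProduct_smul,
          smul_eq_mul, if_true]
        have := Real.mul_self_sqrt (hq y hy).le
        have h0 := (Real.sqrt_pos.2 (hq y hy)).ne'
        change (√(q y))⁻¹ * ((√(q y))⁻¹ * q y) = 1
        field_simp
        rw [sq, this]
      · subst hin
        simp only [Function.update_self, Function.update_of_ne hjn, smul_dotProduct]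
        rw [hwE y hy j (by omega), if_neg (Ne.symm hjn), smul_zero]
      · subst hjn
        simp only [Function.update_self, Function.update_of_ne hin, Matrix.mulVec_smul,
          dotProduct_smul]
        rw [hsym y hy, hwE y hy i (by omega), if_neg hin, smul_zero]
      · simp only [Function.update_of_ne hin, Function.update_of_ne hjn]
        exact h2 y hy i (by omega) j (by omega)
    · intro i hi y k hk
      rcases eq_or_ne i n with rfl | hne
      · simp [hwk y k hk]
      · simp only [Function.update_of_ne hne]
        exact h3 i (by omega) y k hk

/-! ### Tensor powers of matrices -/

namespace Matrix

variable {n : Type*}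

/-- The `p`-th tensor power of a square matrix, acting on arrays of coefficients. -/
def tensorPower (p : ℕ) (A : Matrix n n ℝ) : Matrix (Fin p → n) (Fin p → n) ℝ :=
  Matrix.of fun i l => ∏ k, A (i k) (l k)

theorem tensorPower_mul [Fintype n] (p : ℕ) (A B : Matrix n n ℝ) :
    tensorPower p (A * B) = tensorPower p A * tensorPower p B := by
  ext i l
  simp only [tensorPower, Matrix.of_apply, Matrix.mul_apply, ← Finset.prod_mul_distrib,
    Fintype.prod_sum]

theorem tensorPower_transpose (p : ℕ) (A : Matrix n n ℝ) :
    tensorPower p A.transpose = (tensorPower p A).transpose := rfl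

/-- Either hypothesis identifies the Gram matrix, `Aᵀ A = G⁻¹ = Bᵀ B`. By multiplicativity of tensor
powers the squared norm is the quadratic form of `(Aᵀ A)^{⊗p}`, so it sees `A` only through `G`. -/
theorem norm_tensorPower_mulVec [Fintype n] [DecidableEq n] (p : ℕ) (A B G : Matrix n n ℝ)
    (hA : A * G * A.transpose = 1) (hB : B * G * B.transpose = 1) (c : (Fin p → n) → ℝ) :
    ‖(WithLp.toLp 2 ((tensorPower p A).mulVec c) : EuclideanSpace ℝ (Fin p → n))‖ =
      ‖(WithLp.toLp 2 ((tensorPower p B).mulVec c) : EuclideanSpace ℝ (Fin p → n))‖ := by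
  have hAB : A.transpose * A = B.transpose * B := by
    have h1 : ∀ C : Matrix n n ℝ, C * G * C.transpose = 1 → G * (C.transpose * C) = 1 :=
      fun C hC => by
        rw [Matrix.mul_assoc] at hC
        rw [← Matrix.mul_assoc]
        exact mul_eq_one_comm.1 hC
    have hu : IsUnit G := IsUnit.of_mul_eq_one _ (h1 A hA)
    exact hu.mul_left_cancel ((h1 A hA).trans (h1 B hB).symm)
  have key : ∀ C : Matrix n n ℝ,
      ‖(WithLp.toLp 2 ((tensorPower p C).mulVec c) : EuclideanSpace ℝ (Fin p → n))‖ ^ 2 =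
        c ⬝ᵥ (tensorPower p (C.transpose * C)).mulVec c := fun C => by
    rw [tensorPower_mul, tensorPower_transpose, ← Matrix.mulVec_mulVec, Matrix.dotProduct_mulVec,
      Matrix.vecMul_transpose, EuclideanSpace.norm_sq_eq]
    simp [dotProduct, sq]
  exact (sq_eq_sq₀ (norm_nonneg _) (norm_nonneg _)).1 (by rw [key, key, hAB])

end Matrix

/-! ### Charts, transition maps and frames of a `DC_0` Riemannian manifold -/

namespace DC0Manifold

variable {N : ℕ} {X : Type*} [TopologicalSpace X] [T2Space X] [SigmaCompactSpace X] {Λ : Type*}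
  (M : DC0Manifold N X Λ)

theorem mem_img {α : Λ} {A : Set X} {x : Euc N} :
    x ∈ M.img α A ↔ x ∈ (M.chart α).target ∧ (M.chart α).symm x ∈ A := by
  rw [img, OpenPartialHomeomorph.image_source_inter_eq']
  rfl

theorem mem_overlap {α β : Λ} {A : Set X} {x : Euc N} :
    x ∈ M.overlap α β A ↔ x ∈ (M.chart α).target ∧
      (M.chart α).symm x ∈ (M.chart β).source ∧ (M.chart α).symm x ∈ A :=
  M.mem_img

theorem mem_transition_source {α β : Λ} {x : Euc N} :
    x ∈ (M.transition α β).source ↔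
      x ∈ (M.chart α).target ∧ (M.chart α).symm x ∈ (M.chart β).source := by
  rw [transition, OpenPartialHomeomorph.trans_source]
  rfl

theorem transition_symm (α β : Λ) : (M.transition α β).symm = M.transition β α := by
  rw [transition, OpenPartialHomeomorph.trans_symm_eq_symm_trans_symm,
    OpenPartialHomeomorph.symm_symm]
  rfl

theorem transition_apply (α β : Λ) (x : Euc N) :
    M.transition α β x = M.chart β ((M.chart α).symm x) := rfl

variable {M}

theorem isOpen_img (α : Λ) {A : Set X} (hA : IsOpen A) : IsOpen (M.img α A) :=
  (M.chart α).isOpen_image_source_inter hA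

theorem isOpen_overlap (α β : Λ) {A : Set X} (hA : IsOpen A) : IsOpen (M.overlap α β A) :=
  isOpen_img α ((M.chart β).open_source.inter hA)

theorem overlap_subset_img (α β : Λ) (A : Set X) : M.overlap α β A ⊆ M.img α A := fun _ hx =>
  M.mem_img.2 ⟨(M.mem_overlap.1 hx).1, (M.mem_overlap.1 hx).2.2⟩

theorem overlap_subset_source (α β : Λ) (A : Set X) :
    M.overlap α β A ⊆ (M.transition α β).source := fun _ hx =>
  M.mem_transition_source.2 ⟨(M.mem_overlap.1 hx).1, (M.mem_overlap.1 hx).2.1⟩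

theorem img_subset_target (α : Λ) (A : Set X) : M.img α A ⊆ (M.chart α).target := fun _ hx =>
  (M.mem_img.1 hx).1

theorem symm_transition_apply {α β : Λ} {x : Euc N} (hx : x ∈ (M.transition α β).source) :
    (M.chart β).symm (M.transition α β x) = (M.chart α).symm x :=
  (M.chart β).left_inv (M.mem_transition_source.1 hx).2

theorem transition_mem_overlap {α β : Λ} {A : Set X} {x : Euc N} (hx : x ∈ M.overlap α β A) :
    M.transition α β x ∈ M.overlap β α A := by
  have h := M.mem_overlap.1 hx
  rw [M.mem_overlap, symm_transition_apply (overlap_subset_source α β A hx)]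
  exact ⟨(M.chart β).map_source h.2.1, (M.chart α).map_target h.1, h.2.2⟩

theorem transition_mem_img_iff {α β : Λ} {A : Set X} {x : Euc N}
    (hx : x ∈ (M.transition α β).source) : M.transition α β x ∈ M.img β A ↔ x ∈ M.img α A := by
  have h := M.mem_transition_source.1 hx
  rw [M.mem_img, symm_transition_apply hx, M.mem_img]
  exact ⟨fun h' => ⟨h.1, h'.2⟩, fun h' => ⟨(M.chart β).map_source h.2, h'.2⟩⟩

theorem isCw0_pd (α β : Λ) (j i : Fin N) :
    IsCw0 (M.transition α β).source (M.img α M.sing) (pd (M.transition α β) j i) :=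
  (M.transition_dc0 α β j).grad i

theorem det_fderiv_transition {α β : Λ} {x : Euc N} (hx : x ∈ (M.transition α β).source)
    (hs : x ∉ M.img α M.sing) : (fderiv ℝ (M.transition α β) x).det =
      (Matrix.of fun k i => pd (M.transition α β) k i x).det := by
  have hd : ∀ j, DifferentiableAt ℝ (fun y => M.transition α β y j) x := fun j =>
    (M.transition_dc0 α β j).diff x ⟨hx, hs⟩
  have hd' : DifferentiableAt ℝ (M.transition α β) x := differentiableAt_euclidean.2 hd
  rw [ContinuousLinearMap.det,
    ← LinearMap.det_toMatrix (EuclideanSpace.basisFun (Fin N) ℝ).toBasis]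
  congr 1
  ext k i
  rw [LinearMap.toMatrix_apply, Matrix.of_apply, pd]
  have := ((EuclideanSpace.proj k : Euc N →L[ℝ] ℝ).hasFDerivAt.comp x hd'.hasFDerivAt).fderiv
  have h2 : (fun y => M.transition α β y k) =
      (EuclideanSpace.proj k : Euc N →L[ℝ] ℝ) ∘ M.transition α β := rfl
  rw [h2, this]
  simp [stdVec]

/-- Out of the singular set the determinant is a polynomial in partial derivatives of class
`C_{w,0}`. On the singular set `fderiv` may take its default value, which the class ignores. -/
theorem isCw0_absJacSymm (α β : Λ) :
    IsCw0 (M.transition β α).source (M.img β M.sing) (absJacSymm (M.transition α β)) := by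
  refine (IsCw0.det (M.sing_null β) (M.transition β α).open_source
    (A := fun y => Matrix.of fun k i => pd (M.transition β α) k i y)
    fun k i => isCw0_pd β α k i).abs.congr fun y hy => ?_
  rw [absJacSymm, M.transition_symm, det_fderiv_transition hy.1 hy.2]

theorem metric_eq {α β : Λ} {x : Euc N} (hx : x ∈ (M.transition α β).source)
    (hs : x ∉ M.img α M.sing) :
    M.g α x = (Matrix.of fun k i => pd (M.transition α β) k i x).transpose *
      M.g β (M.transition α β x) * (Matrix.of fun k i => pd (M.transition α β) k i x) := by
  have h := M.mem_transition_source.1 hx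
  have hm : x ∈ M.chart α '' (((M.chart α).source ∩ (M.chart β).source) \ M.sing) :=
    ⟨(M.chart α).symm x, ⟨⟨(M.chart α).map_target h.1, h.2⟩, fun h' =>
      hs (M.mem_img.2 ⟨h.1, h'⟩)⟩, (M.chart α).right_inv h.1⟩
  ext i j
  rw [M.g_compat α β x hm i j]
  simp only [Matrix.mul_apply, Matrix.transpose_apply, Matrix.of_apply, Finset.sum_mul]
  rw [Finset.sum_comm]
  refine Finset.sum_congr rfl fun l _ => Finset.sum_congr rfl fun k _ => ?_
  change pd (M.transition α β) k i x * pd (M.transition α β) l j x *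
    M.g β (M.transition α β x) k l = _
  ring

/-- Square root of `det (Pᵀ G P) = (det P)² det G`. This factor is what compensates the one in the
pull-back of measures. -/
theorem sqrtDetG_transition {α β : Λ} {y : Euc N} (hy : y ∈ (M.transition β α).source)
    (hs : y ∉ M.img β M.sing) :
    M.sqrtDetG β y = absJacSymm (M.transition α β) y * M.sqrtDetG α (M.transition β α y) := by
  rw [absJacSymm, M.transition_symm, det_fderiv_transition hy hs, sqrtDetG, metric_eq hy hs,
    Matrix.det_mul, Matrix.det_mul, Matrix.det_transpose, sqrtDetG, mul_comm, ← mul_assoc,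
    Real.sqrt_mul (mul_self_nonneg _), Real.sqrt_mul_self_eq_abs]

theorem isCw0_sqrtDetG (α : Λ) : IsCw0 (M.chart α).target (M.img α M.sing) (M.sqrtDetG α) :=
  (IsCw0.det (M.sing_null α) (M.chart α).open_target fun i j => M.g_cw0 α i j).sqrt

theorem IsFrame.mul_metric_mul_transpose {Ω : Set X} {α : Λ} {E : Fin N → Euc N → Euc N}
    (hE : M.IsFrame Ω α E) {x : Euc N} (hx : x ∈ M.img α Ω) (hs : x ∉ M.img α M.sing) :
    (Matrix.of fun i k => E i x k) * M.g α x * (Matrix.of fun i k => E i x k).transpose = 1 := by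
  ext i j
  rw [Matrix.one_apply, ← hE.orthonormal x ⟨hx, hs⟩ i j]
  simp only [Matrix.mul_apply, Matrix.transpose_apply, Matrix.of_apply, Finset.sum_mul]
  rw [Finset.sum_comm]
  refine Finset.sum_congr rfl fun l _ => Finset.sum_congr rfl fun k _ => ?_
  ring

theorem exists_isFrame {Ω : Set X} (hΩ : IsOpen Ω) (α : Λ) : ∃ E, M.IsFrame Ω α E := by
  have hsub : M.img α Ω \ M.img α M.sing ⊆ M.chart α '' ((M.chart α).source \ M.sing) := by
    rintro x ⟨hx, hs⟩
    have h := M.mem_img.1 hx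
    exact ⟨(M.chart α).symm x, ⟨(M.chart α).map_target h.1, fun h' =>
      hs (M.mem_img.2 ⟨h.1, h'⟩)⟩, (M.chart α).right_inv h.1⟩
  obtain ⟨c, hc0, -, hcinv, hell⟩ := M.g_elliptic α
  have hq : ∀ x, ∀ u v : Fin N → ℝ, u ⬝ᵥ (M.g α x).mulVec v =
      ∑ i, ∑ j, M.g α x i j * u i * v j := fun x u v => by
    simp only [dotProduct, Matrix.mulVec, Finset.mul_sum]
    exact Finset.sum_congr rfl fun i _ => Finset.sum_congr rfl fun j _ => by ring
  have hcx : ∀ x ∈ M.img α Ω, 0 < c x := fun x hx => hc0 x (img_subset_target α Ω hx)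
  obtain ⟨E, hEc, hEo⟩ := exists_continuousOn_orthonormal (G := M.g α)
    (T := M.img α Ω \ M.img α M.sing)
    (fun i j => (M.g_cw0 α i j).cont.mono (sdiff_subset_sdiff_left (img_subset_target α Ω)))
    (fun x hx => M.g_symm α x (hsub hx))
    (fun x hx v hv => by
      rw [hq]
      refine lt_of_lt_of_le ?_ (hell x (hsub hx) (WithLp.toLp 2 v)).2
      have : 0 < ‖(WithLp.toLp 2 v : Euc N)‖ := norm_pos_iff.2 (by simpa using hv)
      have := hcx x hx.1
      positivity)
  refine ⟨fun i x => WithLp.toLp 2 (E i x), fun i k => ⟨M.sing_null α, hEc i i.2 k, ?_⟩,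
    fun x hx i j => ?_⟩
  -- Ellipticity gives `c ‖E i‖² ≤ g(E i, E i) = 1`, so each component is at most `√(c⁻¹)`, and
  -- `c⁻¹` is locally bounded.
  · refine (hcinv.mono (isOpen_img α hΩ) (img_subset_target α Ω) (empty_subset _)).mono_of_le
      (φ := fun C => √C) fun x hx C hC => ?_
    refine Real.abs_le_sqrt ?_
    have h1 := (hell x (hsub hx) (WithLp.toLp 2 (E i x))).2
    have h2 := hEo x hx i i.2 i i.2
    rw [if_pos rfl, hq] at h2
    have h3 : (E i x k) ^ 2 ≤ ‖(WithLp.toLp 2 (E i x) : Euc N)‖ ^ 2 := by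
      rw [EuclideanSpace.norm_sq_eq]
      refine le_trans (by simp) (Finset.single_le_sum
        (f := fun k => ‖(WithLp.toLp 2 (E i x) : Euc N) k‖ ^ 2)
        (fun _ _ => by positivity) (Finset.mem_univ k))
    have h4 := hcx x hx.1
    have h5 : c x * ‖(WithLp.toLp 2 (E i x) : Euc N)‖ ^ 2 ≤ 1 := h1.trans h2.le
    have h6 : ‖(WithLp.toLp 2 (E i x) : Euc N)‖ ^ 2 ≤ (c x)⁻¹ := by
      rwa [← one_div, le_div_iff₀' h4]
    exact h3.trans (h6.trans ((le_abs_self _).trans hC))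
  · have h := hEo x hx i i.2 j j.2
    rw [hq] at h
    rw [h]
    simp [Fin.ext_iff]

end DC0Manifold

/-! ### The local norm of a tensor -/

/-- Densities are available on compact sets only; this exhaustion carries their consequences over to
open sets. -/
theorem IsOpen.exists_iUnion_isCompact {N : ℕ} {W : Set (Euc N)} (hW : IsOpen W) :
    ∃ K : ℕ → Set (Euc N), (∀ n, IsCompact (K n)) ∧ (∀ n, K n ⊆ W) ∧ ⋃ n, K n = W := by
  obtain ⟨F, hFc, hFW, hFU, hFm⟩ := hW.exists_iUnion_isClosed
  refine ⟨fun n => F n ∩ Metric.closedBall 0 n, fun n =>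
    (isCompact_closedBall _ _).inter_left (hFc n), fun n => inter_subset_left.trans (hFW n),
    subset_antisymm (iUnion_subset fun n => inter_subset_left.trans (hFW n)) fun x hx => ?_⟩
  rw [← hFU] at hx
  obtain ⟨m, hm⟩ := mem_iUnion.1 hx
  obtain ⟨n, hn⟩ := exists_nat_ge ‖x‖
  refine mem_iUnion.2 ⟨max m n, hFm (le_max_left m n) hm, ?_⟩
  rw [mem_closedBall_zero_iff]
  exact hn.trans (by exact_mod_cast le_max_right m n)

theorem OpenPartialHomeomorph.measurable_indicator {N : ℕ}
    (F : OpenPartialHomeomorph (Euc N) (Euc N)) : Measurable (F.source.indicator F) := by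
  classical
  rw [← piecewise_eq_indicator]
  exact F.continuousOn.measurable_piecewise continuousOn_const F.open_source.measurableSet

/-- On `K` the function `h` is bounded out of `S`, which `lam` does not charge, so the product of
measures becomes the product of densities. -/
theorem RadonFamily.density_eq {N : ℕ} {μ : RadonFamily N ℝ} {K W S : Set (Euc N)}
    {lam : Measure (Euc N)} {f h : Euc N → ℝ} (hW : IsOpen W) (hK : IsCompact K) (hKW : K ⊆ W)
    (hc : lam Kᶜ = 0) (hS : lam S = 0) (hf : Integrable f lam) (hμ : μ K = lam.withDensityᵥ f)
    (hh : IsCw0 W S h) : Integrable (fun x => h x * f x) lam ∧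
      RadonFamily.density h μ K = lam.withDensityᵥ (fun x => h x * f x) := by
  have hm : AEStronglyMeasurable h lam :=
    hh.aestronglyMeasurable hW.measurableSet (measure_mono_null (compl_subset_compl.2 hKW) hc) hS
  obtain ⟨C, hC⟩ := hh.exists_ae_bound hK hKW hc hS
  refine ⟨hf.bdd_mul hm hC, ?_⟩
  rw [RadonFamily.density, hμ, Measure.withDensityᵥ_withDensity hf hm hC]

namespace DC0Manifold

variable {N : ℕ} {X : Type*} [TopologicalSpace X] [T2Space X] [SigmaCompactSpace X] {Λ : Type*}
  {M : DC0Manifold N X Λ} {Ω : Set X} {p : ℕ}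

theorem IsFrame.isCw0_prod (hΩ : IsOpen Ω) {α : Λ} {E : Fin N → Euc N → Euc N}
    (hE : M.IsFrame Ω α E) (i j : Fin p → Fin N) :
    IsCw0 (M.img α Ω) (M.img α M.sing) (fun x => ∏ k, E (i k) x (j k)) :=
  IsCw0.prod (M.sing_null α) (isOpen_img α hΩ) _ fun _ _ => hE.cw0 _ _

namespace GMTensor

variable (S : M.GMTensor Ω p)

/-- The sum of the variations of the finitely many components dominates each of them, and inherits
from them both its support and the vanishing on negligible sets. -/
theorem exists_density {α : Λ} {K : Set (Euc N)} (hK : IsCompact K) (hKΩ : K ⊆ M.img α Ω) :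
    ∃ (lam : Measure (Euc N)) (f : (Fin p → Fin N) → Euc N → ℝ), IsFiniteMeasure lam ∧
      lam Kᶜ = 0 ∧ (∀ B, HNull B → lam B = 0) ∧
      ∀ j, Integrable (f j) lam ∧ S.comp α j K = lam.withDensityᵥ (f j) := by
  let lam : Measure (Euc N) := Measure.sum fun j => (S.comp α j K).variation
  have hfin : IsFiniteMeasure lam := by
    have := fun j => SignedMeasure.isFiniteMeasure_variation (S.comp α j K)
    refine ⟨?_⟩
    rw [Measure.sum_apply _ MeasurableSet.univ, tsum_fintype]
    exact ENNReal.sum_lt_top.2 fun j _ => measure_lt_top _ _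
  choose f hf using fun j => SignedMeasure.exists_density (S.comp α j K) (lam := lam)
    (Measure.le_sum (fun j => (S.comp α j K).variation) j)
  refine ⟨lam, f, hfin, ?_, fun B hB => ?_, hf⟩
  · rw [Measure.sum_apply _ hK.measurableSet.compl, ENNReal.tsum_eq_zero]
    exact fun j => RadonFamily.variation_compl (S.isGM α j).radon hK hKΩ
  · obtain ⟨B', hBB', hB', hn⟩ := hB.exists_measurableSet_superset
    refine measure_mono_null hBB' ?_
    rw [Measure.sum_apply _ hB', ENNReal.tsum_eq_zero]
    intro j
    rw [VectorMeasure.variation_apply_eq_zero hB']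
    exact fun t ht htm => (S.isGM α j).vanish K hK hKΩ t htm
      (measure_mono_null ht hn)

variable {S}

/-- Evaluating on the frame applies the tensor power of its matrix to the vector of densities, and
the variation of a measure with a density has the norm of that density as its own. -/
theorem variation_eval (hΩ : IsOpen Ω) {α : Λ} {E : Fin N → Euc N → Euc N}
    (hE : M.IsFrame Ω α E) {K : Set (Euc N)} (hK : IsCompact K) (hKΩ : K ⊆ M.img α Ω)
    {lam : Measure (Euc N)} (hc : lam Kᶜ = 0) (hs : lam (M.img α M.sing) = 0)
    {f : (Fin p → Fin N) → Euc N → ℝ} (hf : ∀ j, Integrable (f j) lam)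
    (hS : ∀ j, S.comp α j K = lam.withDensityᵥ (f j)) :
    Integrable (fun x => (WithLp.toLp 2 ((Matrix.tensorPower p
      (Matrix.of fun i k => E i x k)).mulVec fun j => f j x) :
        EuclideanSpace ℝ (Fin p → Fin N))) lam ∧
    (RadonFamily.pi (S.eval α E) K).variation = lam.withDensity fun x =>
      ‖(WithLp.toLp 2 ((Matrix.tensorPower p
        (Matrix.of fun i k => E i x k)).mulVec fun j => f j x) :
          EuclideanSpace ℝ (Fin p → Fin N))‖ₑ := by
  have hd := fun i j => RadonFamily.density_eq (isOpen_img α hΩ) hK hKΩ hc hs (hf j) (hS j)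
    (hE.isCw0_prod hΩ i j)
  have hi : ∀ i : Fin p → Fin N,
      Integrable (fun x => ∑ j : Fin p → Fin N, (∏ k, E (i k) x (j k)) * f j x) lam :=
    fun i => integrable_finsetSum _ fun j _ => (hd i j).1
  have he : ∀ i, S.eval α E i K =
      lam.withDensityᵥ fun x => ∑ j : Fin p → Fin N, (∏ k, E (i k) x (j k)) * f j x := fun i => by
    rw [← Measure.withDensityᵥ_finsetSum _ fun j _ => (hd i j).1, eval, Finset.sum_apply]
    exact Finset.sum_congr rfl fun j _ => (hd i j).2
  have hpi := RadonFamily.pi_eq_withDensityᵥ hi he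
  refine ⟨hpi.1, ?_⟩
  rw [hpi.2, Measure.variation_withDensityᵥ hpi.1]
  rfl

theorem isRadon_eval (hΩ : IsOpen Ω) {α : Λ} {E : Fin N → Euc N → Euc N}
    (hE : M.IsFrame Ω α E) (i : Fin p → Fin N) : IsRadon (M.img α Ω) (S.eval α E i) := by
  intro K L hK hL hKL hLΩ
  have hKm := hK.measurableSet
  -- Restriction is exchanged with multiplication by a density below, for which integrability on the
  -- larger compact set is used.
  have hint : ∀ j, (S.comp α j L).Integrable (fun x => ∏ k, E (i k) x (j k)) := fun j => by
    have hcw := hE.isCw0_prod hΩ i j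
    have hc := RadonFamily.variation_compl (S.isGM α j).radon hL hLΩ
    have hs : (S.comp α j L).variation (M.img α M.sing) = 0 := by
      obtain ⟨B', hBB', hB', hn⟩ := (M.sing_null α).exists_measurableSet_superset
      refine measure_mono_null hBB' ?_
      rw [VectorMeasure.variation_apply_eq_zero hB']
      exact fun t ht htm => (S.isGM α j).vanish L hL hLΩ t htm (measure_mono_null ht hn)
    have := SignedMeasure.isFiniteMeasure_variation (S.comp α j L)
    obtain ⟨C, hC⟩ := hcw.exists_ae_bound hL hLΩ hc hs
    exact Integrable.of_bound (hcw.aestronglyMeasurable (isOpen_img α hΩ).measurableSet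
      (measure_mono_null (compl_subset_compl.2 hLΩ) hc) hs) C hC
  have hr : ∀ v : VectorMeasure (Euc N) ℝ,
      v.restrict K = VectorMeasure.restrictGm K v := fun _ => rfl
  rw [eval, Finset.sum_apply, Finset.sum_apply, hr, map_sum]
  refine Finset.sum_congr rfl fun j _ => ?_
  rw [← hr, RadonFamily.density, RadonFamily.density, VectorMeasure.restrict_withDensity (hint j),
    (S.isGM α j).radon K L hK hL hKL hLΩ]

theorem localNorm_restrict (hΩ : IsOpen Ω) {α : Λ} {E : Fin N → Euc N → Euc N}
    (hE : M.IsFrame Ω α E) {K : Set (Euc N)} (hK : IsCompact K) (hKΩ : K ⊆ M.img α Ω) :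
    (S.localNorm α E).restrict K = (RadonFamily.pi (S.eval α E) K).variation :=
  RadonFamily.totalVariation_restrict (RadonFamily.isRadon_pi fun i => isRadon_eval hΩ hE i) hK hKΩ

theorem isPosGM_localNorm (hΩ : IsOpen Ω) {α : Λ} {E : Fin N → Euc N → Euc N}
    (hE : M.IsFrame Ω α E) : _root_.IsPosGM (M.img α Ω) (S.localNorm α E) where
  finite K hK hKΩ := by
    obtain ⟨lam, f, hfin, hc, hn, hf⟩ := S.exists_density hK hKΩ
    have h := variation_eval hΩ hE hK hKΩ hc (hn _ (M.sing_null α)) (fun j => (hf j).1)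
      fun j => (hf j).2
    rw [← Measure.restrict_apply_self, localNorm_restrict hΩ hE hK hKΩ, h.2,
      withDensity_apply _ hK.measurableSet]
    exact (setLIntegral_le_lintegral _ _).trans_lt h.1.2
  conc := RadonFamily.totalVariation_compl (isOpen_img α hΩ).measurableSet
    (RadonFamily.isRadon_pi fun i => isRadon_eval hΩ hE i)
  vanish B hBΩ hB := by
    obtain ⟨K, hK, hKΩ, hU⟩ := (isOpen_img α hΩ (M := M)).exists_iUnion_isCompact
    rw [← hU] at hBΩ
    rw [← inter_eq_left.2 hBΩ, inter_iUnion]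
    refine measure_iUnion_null fun n => ?_
    obtain ⟨lam, f, hfin, hc, hn, hf⟩ := S.exists_density (hK n) (hKΩ n)
    rw [← Measure.restrict_apply' (hK n).measurableSet, localNorm_restrict hΩ hE (hK n) (hKΩ n),
      (variation_eval hΩ hE (hK n) (hKΩ n) hc (hn _ (M.sing_null α)) (fun j => (hf j).1)
      fun j => (hf j).2).2]
    exact withDensity_absolutelyContinuous _ _ (hn B hB)

/-- Both sides become densities against the push-forward of one measure `lam` on `F(K)`. On the left
the density is the norm of `|det dF⁻¹| (A Pᵀ)^{⊗p} f`, on the right that of `A'^{⊗p} f` times the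
same factor. Both `A Pᵀ` and `A'` are orthonormal for the metric of `β` at `F x`. -/
theorem variation_eval_transition (hΩ : IsOpen Ω) {α β : Λ} {E E' : Fin N → Euc N → Euc N}
    (hE : M.IsFrame Ω α E) (hE' : M.IsFrame Ω β E') {K : Set (Euc N)} (hK : IsCompact K)
    (hKΩ : K ⊆ M.overlap α β Ω) :
    (RadonFamily.pi (S.eval α E) K).variation =
      ((RadonFamily.pi (S.eval β E') (M.transition α β '' K)).variation.withDensity fun y =>
        ENNReal.ofReal (absJacSymm (M.transition α β) y)).map
        ((M.transition α β).target.indicator (M.transition α β).symm) := by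
  set F := M.transition α β with hF
  set L := F '' K
  have hKs : K ⊆ F.source := hKΩ.trans (overlap_subset_source α β Ω)
  have hL : IsCompact L := hK.image_of_continuousOn (F.continuousOn.mono hKs)
  have hLo : L ⊆ M.overlap β α Ω := by
    rintro _ ⟨x, hx, rfl⟩
    exact transition_mem_overlap (hKΩ hx)
  have hLs : L ⊆ (M.transition β α).source := hLo.trans (overlap_subset_source β α Ω)
  obtain ⟨lam, f, hfin, hc, hn, hf⟩ := S.exists_density hL (hLo.trans (overlap_subset_img β α Ω))
  -- `G` and `H` are `F⁻¹` and `F` extended by zero to Borel maps of the whole space. As `lam` is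
  -- carried by `L`, they are mutually inverse almost everywhere.
  set G := F.target.indicator F.symm with hGdef
  set H := F.source.indicator F
  have hG : Measurable G := F.symm.measurable_indicator
  have hH : Measurable H := F.measurable_indicator
  have hGF : ∀ x ∈ K, G (F x) = x := fun x hx => by
    rw [hGdef, indicator_of_mem (F.map_source (hKs hx)), F.left_inv (hKs hx)]
  have hHF : ∀ x ∈ K, H x = F x := fun x hx => indicator_of_mem (hKs hx) _
  have hcL : ∀ᵐ y ∂lam, y ∈ L := hc
  have hHG : ∀ᵐ y ∂lam, H (G y) = y := by
    filter_upwards [hcL] with y hy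
    obtain ⟨x, hx, rfl⟩ := hy
    rw [hGF x hx, hHF x hx]
  have hcK : lam.map G Kᶜ = 0 := by
    rw [Measure.map_apply hG hK.measurableSet.compl]
    refine measure_mono_null (fun y hy => ?_) hc
    rintro ⟨x, hx, rfl⟩
    exact hy (by rw [hGF x hx]; exact hx)
  -- The two chart images of the singular set correspond under `F`. Since they may fail to be Borel,
  -- a null Borel hull is chosen in the chart `β` and pulled back by `H`.
  have hsK : lam.map G (M.img α M.sing) = 0 := by
    set T := toMeasurable lam (M.img β M.sing)
    have hT : lam T = 0 := (measure_toMeasurable _).trans (hn _ (M.sing_null β))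
    have hTm : MeasurableSet T := measurableSet_toMeasurable _ _
    have h1 : lam.map G (H ⁻¹' T) = 0 := by
      rw [Measure.map_apply hG (hH hTm)]
      refine measure_mono_null (t := T ∪ {y | ¬ H (G y) = y}) (fun y hy => ?_)
        (measure_union_null hT hHG)
      by_cases h : H (G y) = y
      · left
        have : H (G y) ∈ T := hy
        rwa [h] at this
      · exact Or.inr h
    refine measure_mono_null (t := H ⁻¹' T ∪ Kᶜ) (fun x hx => ?_) (measure_union_null h1 hcK)
    by_cases hxK : x ∈ K
    · left
      rw [mem_preimage, hHF x hxK]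
      exact subset_toMeasurable _ _ ((transition_mem_img_iff (hKs hxK)).2 hx)
    · exact Or.inr hxK
  have hJ := isCw0_absJacSymm (M := M) α β
  have hJd := fun j => RadonFamily.density_eq (M.transition β α).open_source hL hLs hc
    (hn _ (M.sing_null β)) (hf j).1 (hf j).2 hJ
  have hpb : ∀ j, Integrable (fun x => absJacSymm F (H x) * f j (H x)) (lam.map G) ∧
      RadonFamily.pullback F (S.comp β j) K =
        (lam.map G).withDensityᵥ fun x => absJacSymm F (H x) * f j (H x) := fun j => by
    have h := Measure.map_withDensityᵥ hG hH hHG (hJd j).1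
    exact ⟨h.1, by rw [RadonFamily.pullback, (hJd j).2, h.2]⟩
  have hpd : ∀ i j : Fin p → Fin N, IsCw0 F.source (M.img α M.sing)
      (fun x => ∏ k, pd F (j k) (i k) x) := fun i j =>
    IsCw0.prod (M.sing_null α) F.open_source _ fun k _ => isCw0_pd α β (j k) (i k)
  have hpt := fun i j => RadonFamily.density_eq F.open_source hK hKs hcK hsK (hpb j).1 (hpb j).2
    (hpd i j)
  have hα : ∀ i, S.comp α i K = (lam.map G).withDensityᵥ fun x =>
      ∑ j : Fin p → Fin N, (∏ k, pd F (j k) (i k) x) * (absJacSymm F (H x) * f j (H x)) :=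
    fun i => by
    rw [← S.compat α β i K hK hKΩ, pullbackTensor, Finset.sum_apply,
      ← Measure.withDensityᵥ_finsetSum _ fun j _ => (hpt i j).1]
    exact Finset.sum_congr rfl fun j _ => (hpt i j).2
  have hvα := variation_eval hΩ hE hK (hKΩ.trans (overlap_subset_img α β Ω)) hcK hsK
    (fun i => integrable_finsetSum _ fun j _ => (hpt i j).1) hα
  have hvβ := variation_eval hΩ hE' hL (hLo.trans (overlap_subset_img β α Ω)) hc
    (hn _ (M.sing_null β)) (fun j => (hf j).1) fun j => (hf j).2
  have hJm : AEMeasurable (fun y => ENNReal.ofReal (absJacSymm F y)) lam :=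
    (hJ.aestronglyMeasurable (M.transition β α).open_source.measurableSet
      (measure_mono_null (compl_subset_compl.2 hLs) hc)
      (hn _ (M.sing_null β))).aemeasurable.ennreal_ofReal
  rw [hvα.2, hvβ.2, ← withDensity_mul₀ hvβ.1.1.enorm hJm,
    Measure.map_withDensity_comp hG hH hHG (hvβ.1.1.enorm.mul hJm)]
  refine withDensity_congr_ae ?_
  have hxK : ∀ᵐ x ∂lam.map G, x ∈ K := hcK
  have hxS : ∀ᵐ x ∂lam.map G, x ∉ M.img α M.sing := by rw [ae_iff]; simpa using hsK
  filter_upwards [hxK, hxS] with x hx hxs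
  rw [hHF x hx, Pi.mul_apply]
  set P : Matrix (Fin N) (Fin N) ℝ := Matrix.of fun k i => pd F k i x with hP
  set A : Matrix (Fin N) (Fin N) ℝ := Matrix.of fun i k => E i x k with hA
  set A' : Matrix (Fin N) (Fin N) ℝ := Matrix.of fun i k => E' i (F x) k with hA'
  have hJ0 : 0 ≤ absJacSymm F (F x) := abs_nonneg _
  have h1 : (fun i => ∑ j : Fin p → Fin N,
      (∏ k, pd F (j k) (i k) x) * (absJacSymm F (F x) * f j (F x))) =
      absJacSymm F (F x) • (Matrix.tensorPower p P.transpose).mulVec fun j => f j (F x) := by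
    ext i
    simp only [Matrix.mulVec, dotProduct, Pi.smul_apply, smul_eq_mul, Finset.mul_sum,
      Matrix.tensorPower, Matrix.of_apply, Matrix.transpose_apply, hP]
    exact Finset.sum_congr rfl fun j _ => by ring
  have hgA : (A * P.transpose) * M.g β (F x) * (A * P.transpose).transpose = 1 := by
    have h2 := hE.mul_metric_mul_transpose (overlap_subset_img α β Ω (hKΩ hx)) hxs
    rw [metric_eq (hKs hx) hxs] at h2
    rw [← h2, Matrix.transpose_mul, Matrix.transpose_transpose]
    simp only [Matrix.mul_assoc]
    rfl
  have hgA' : A' * M.g β (F x) * A'.transpose = 1 :=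
    hE'.mul_metric_mul_transpose
      (overlap_subset_img β α Ω (transition_mem_overlap (hKΩ hx)))
      fun h => hxs ((transition_mem_img_iff (hKs hx)).1 h)
  have h3 := Matrix.norm_tensorPower_mulVec p _ _ _ hgA hgA' fun j => f j (F x)
  rw [h1, Matrix.mulVec_smul, Matrix.mulVec_mulVec, ← Matrix.tensorPower_mul, WithLp.toLp_smul,
    enorm_smul, mul_comm, Real.enorm_of_nonneg hJ0, ← ofReal_norm, h3, ofReal_norm]

/-- Both measures live on the overlap, so it suffices to compare them on an exhaustion by compact
sets, where `variation_eval_transition` applies. -/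
theorem pullbackPos_localNorm (hΩ : IsOpen Ω) {α β : Λ} {E E' : Fin N → Euc N → Euc N}
    (hE : M.IsFrame Ω α E) (hE' : M.IsFrame Ω β E') :
    pullbackPos (M.transition α β) (M.overlap β α Ω) (S.localNorm β E') =
      (S.localNorm α E).restrict (M.overlap α β Ω) := by
  set F := M.transition α β with hF
  set W := M.overlap α β Ω with hW
  set W' := M.overlap β α Ω with hW'
  have hWo : IsOpen W := isOpen_overlap α β hΩ
  have hW'o : IsOpen W' := isOpen_overlap β α hΩ
  have hW't : W' ⊆ F.target := by
    have := overlap_subset_source (M := M) β α Ω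
    rwa [← M.transition_symm α β] at this
  have hsymm : ∀ y ∈ W', F.symm y ∈ W := fun y hy => by
    rw [hF, M.transition_symm]
    exact transition_mem_overlap hy
  set m := ((S.localNorm β E').restrict W').withDensity
    fun y => ENNReal.ofReal (absJacSymm F y) with hm
  have hac : m ≪ (S.localNorm β E').restrict W' := withDensity_absolutelyContinuous _ _
  have hae : AEMeasurable F.symm m :=
    ((F.continuousOn_symm.mono hW't).aemeasurable hW'o.measurableSet).mono_ac hac
  have hmc : m W'ᶜ = 0 := hac (by rw [Measure.restrict_apply hW'o.measurableSet.compl]; simp)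
  have hGae : F.symm =ᵐ[m] F.target.indicator F.symm := by
    have : ∀ᵐ y ∂m, y ∈ W' := hmc
    filter_upwards [this] with y hy
    rw [indicator_of_mem (hW't hy)]
  have hG : Measurable (F.target.indicator F.symm) := F.symm.measurable_indicator
  change m.map F.symm = _
  have hres : m.map F.symm = (m.map F.symm).restrict W := by
    refine (Measure.restrict_eq_self_of_ae_mem ?_).symm
    change m.map F.symm Wᶜ = 0
    rw [Measure.map_apply_of_aemeasurable hae hWo.measurableSet.compl]
    exact measure_mono_null (fun y hy hy' => hy (hsymm y hy')) hmc
  rw [hres]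
  obtain ⟨K, hK, hKW, hU⟩ := hWo.exists_iUnion_isCompact
  rw [← hU, Measure.restrict_iUnion_congr]
  intro n
  have hLo : F '' K n ⊆ W' := by
    rintro _ ⟨x, hx, rfl⟩
    exact transition_mem_overlap (hKW n hx)
  have hL : IsCompact (F '' K n) := (hK n).image_of_continuousOn
    (F.continuousOn.mono ((hKW n).trans (overlap_subset_source α β Ω)))
  rw [localNorm_restrict hΩ hE (hK n) ((hKW n).trans (overlap_subset_img α β Ω)),
    variation_eval_transition hΩ hE hE' (hK n) (hKW n),
    ← localNorm_restrict hΩ hE' hL (hLo.trans (overlap_subset_img β α Ω)),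
    Measure.map_congr hGae, Measure.restrict_map hG (hK n).measurableSet]
  congr 1
  rw [← restrict_withDensity hL.measurableSet]
  have hpre : F '' K n ⊆ F.target.indicator F.symm ⁻¹' K n := by
    rintro _ ⟨x, hx, rfl⟩
    have hxs := overlap_subset_source α β Ω (hKW n hx)
    rw [mem_preimage, indicator_of_mem (F.map_source hxs), F.left_inv hxs]
    exact hx
  -- Off the target the extended map takes the value 0, which may lie in `K n`; intersecting with
  -- `W'` discards those points.
  have hpre' : (F.target.indicator F.symm ⁻¹' K n) ∩ W' = F '' K n := by
    refine subset_antisymm ?_ (subset_inter hpre hLo)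
    rintro y ⟨hy, hy'⟩
    rw [mem_preimage, indicator_of_mem (hW't hy')] at hy
    exact ⟨_, hy, F.right_inv (hW't hy')⟩
  rw [hm, ← restrict_withDensity hW'o.measurableSet,
    Measure.restrict_restrict (hG (hK n).measurableSet), hpre']

end GMTensor

end DC0Manifold

/-! ### Gluing measures -/

theorem ContinuousOn.measurableSet_inter_preimage_of_measurableSet {Y Z : Type*}
    [TopologicalSpace Y] [MeasurableSpace Y] [BorelSpace Y] [TopologicalSpace Z]
    [MeasurableSpace Z] [BorelSpace Z] {f : Y → Z} {s : Set Y} (hf : ContinuousOn f s)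
    (hs : MeasurableSet s) {B : Set Z} (hB : MeasurableSet B) : MeasurableSet (s ∩ f ⁻¹' B) := by
  have h : MeasurableSet (s.domRestrict f ⁻¹' B) := hf.domRestrict.measurable hB
  have := hs.subtype_image h
  convert this using 1
  ext x
  simp [Set.domRestrict, and_comm]

/-- Measures which agree on the intersections of a cover with a countable subcover come from a
global measure. -/
theorem MeasureTheory.Measure.exists_glue {Y ι : Type*} [MeasurableSpace Y] {U : ι → Set Y}
    (hU : ∀ i, MeasurableSet (U i)) (t : Set ι) (ht : t.Countable)
    (hcov : ∀ i, U i ⊆ ⋃ j ∈ t, U j) (ν : ι → Measure Y)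
    (hν : ∀ i j B, MeasurableSet B → B ⊆ U i ∩ U j → ν i B = ν j B) :
    ∃ μ : Measure Y, (∀ i B, MeasurableSet B → B ⊆ U i → μ B = ν i B) ∧ μ (⋃ i, U i)ᶜ = 0 := by
  rcases t.eq_empty_or_nonempty with rfl | hne
  · refine ⟨0, fun i B _ hB => ?_, by simp⟩
    have : B = ∅ := subset_empty_iff.1 (hB.trans ((hcov i).trans (by simp)))
    simp [this]
  obtain ⟨a, rfl⟩ := ht.exists_eq_range hne
  simp only [mem_range, iUnion_exists, iUnion_iUnion_eq'] at hcov
  have hD : ∀ n, MeasurableSet (disjointed (fun n => U (a n)) n) := fun n =>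
    MeasurableSet.disjointed (fun n => hU (a n)) n
  -- Each point is measured by the first set of the subcover that contains it, so that nothing is
  -- counted twice.
  refine ⟨Measure.sum fun n => (ν (a n)).restrict (disjointed (fun n => U (a n)) n),
    fun i B hB hBU => ?_, ?_⟩
  · have hBD : B = ⋃ n, B ∩ disjointed (fun n => U (a n)) n := by
      rw [← inter_iUnion, iUnion_disjointed, inter_eq_left.2 (hBU.trans (hcov i))]
    rw [Measure.sum_apply _ hB]
    conv_rhs => rw [hBD]
    rw [measure_iUnion (fun m n hmn => ((disjoint_disjointed _) hmn).mono inter_subset_right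
      inter_subset_right) fun n => hB.inter (hD n)]
    refine tsum_congr fun n => ?_
    rw [Measure.restrict_apply hB]
    exact hν _ _ _ (hB.inter (hD n)) (subset_inter
      (inter_subset_right.trans (disjointed_subset _ _)) (inter_subset_left.trans hBU))
  -- The index type may be uncountable; measurability comes from the countable subcover.
  · have hm : MeasurableSet (⋃ i, U i)ᶜ := by
      have : ⋃ i, U i = ⋃ n, U (a n) := subset_antisymm (iUnion_subset hcov)
        (iUnion_subset fun n => subset_iUnion U (a n))
      rw [this]
      exact (MeasurableSet.iUnion fun n => hU (a n)).compl
    rw [Measure.sum_apply _ hm, ENNReal.tsum_eq_zero]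
    intro n
    rw [Measure.restrict_apply hm]
    refine measure_mono_null (t := ∅) (fun x hx => ?_) measure_empty
    exact hx.1 (mem_iUnion.2 ⟨a n, disjointed_subset (fun n => U (a n)) n hx.2⟩)

/-! ### Nonnegative measures of class `GM` -/

namespace IsPosGM

variable {N : ℕ} {Ω S : Set (Euc N)} {μ : Measure (Euc N)}

theorem null (hμ : IsPosGM Ω μ) (hS : HNull S) : μ S = 0 := by
  refine measure_mono_null (t := (S ∩ Ω) ∪ Ωᶜ) (fun x hx => ?_) (measure_union_null
    (hμ.vanish _ inter_subset_right (measure_mono_null inter_subset_left hS)) hμ.conc)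
  by_cases h : x ∈ Ω
  · exact Or.inl ⟨hx, h⟩
  · exact Or.inr h

theorem aestronglyMeasurable (hμ : IsPosGM Ω μ) (hΩ : IsOpen Ω) {h : Euc N → ℝ}
    (hh : IsCw0 Ω S h) : AEStronglyMeasurable h μ :=
  hh.aestronglyMeasurable hΩ.measurableSet hμ.conc (hμ.null hh.null)

theorem withDensity (hμ : IsPosGM Ω μ) {h : Euc N → ℝ} (hh : IsCw0 Ω S h) :
    IsPosGM Ω (μ.withDensity fun x => ENNReal.ofReal (h x)) where
  finite K hK hKΩ := by
    have hfin : μ K < ⊤ := hμ.finite K hK hKΩ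
    obtain ⟨C, hC⟩ := hh.exists_ae_bound (μ := μ.restrict K) hK hKΩ
      (by rw [Measure.restrict_apply hK.measurableSet.compl]; simp)
      (Measure.absolutelyContinuous_of_le Measure.restrict_le_self (hμ.null hh.null))
    rw [withDensity_apply _ hK.measurableSet]
    calc ∫⁻ x in K, ENNReal.ofReal (h x) ∂μ ≤ ∫⁻ _ in K, ENNReal.ofReal C ∂μ :=
          lintegral_mono_ae (hC.mono fun x hx => ENNReal.ofReal_le_ofReal ((le_abs_self _).trans hx))
      _ < ⊤ := by
          rw [setLIntegral_const]
          exact ENNReal.mul_lt_top ENNReal.ofReal_lt_top hfin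
  conc := withDensity_absolutelyContinuous _ _ hμ.conc
  vanish B hB h0 := withDensity_absolutelyContinuous _ _ (hμ.vanish B hB h0)

end IsPosGM

/-! ### The induced measure on the manifold -/

namespace DC0Manifold

variable {N : ℕ} {X : Type*} [TopologicalSpace X] [T2Space X] [SigmaCompactSpace X]
  {Λ : Type*} {M : DC0Manifold N X Λ} {Ω : Set X} {p : ℕ}

theorem isCw0_sqrtDetG_img (hΩ : IsOpen Ω) (α : Λ) :
    IsCw0 (M.img α Ω) (M.img α M.sing) (M.sqrtDetG α) :=
  (isCw0_sqrtDetG α).mono (isOpen_img α hΩ) (img_subset_target α Ω)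

/-- Change of variables along the transition map: the pull-back contributes `|det dF⁻¹|`, and
`sqrtDetG_transition` absorbs it into the weight. The case `α = β` gives independence of the frame.
-/
theorem GMTensor.setLIntegral_sqrtDetG_eq [MeasurableSpace X] [BorelSpace X] {S : M.GMTensor Ω p}
    (hΩ : IsOpen Ω) {α β : Λ} {E E' : Fin N → Euc N → Euc N} (hE : M.IsFrame Ω α E)
    (hE' : M.IsFrame Ω β E') {B : Set X} (hB : MeasurableSet B)
    (hBα : B ⊆ (M.chart α).source ∩ Ω) (hBβ : B ⊆ (M.chart β).source ∩ Ω) :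
    ∫⁻ x in M.chart α '' B, ENNReal.ofReal (M.sqrtDetG α x) ∂(S.localNorm α E) =
      ∫⁻ x in M.chart β '' B, ENNReal.ofReal (M.sqrtDetG β x) ∂(S.localNorm β E') := by
  have hμα := isPosGM_localNorm (S := S) hΩ hE
  have hμβ := isPosGM_localNorm (S := S) hΩ hE'
  set F := M.transition α β with hF
  set W := M.overlap α β Ω with hW
  set W' := M.overlap β α Ω with hW'
  have hW'o : IsOpen W' := isOpen_overlap β α hΩ
  have hW't : W' ⊆ F.target := by
    have := overlap_subset_source (M := M) β α Ω
    rwa [← M.transition_symm α β] at this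
  set G := F.target.indicator F.symm with hGdef
  have hG : Measurable G := F.symm.measurable_indicator
  have hGW : ∀ y ∈ W', G y = M.transition β α y := fun y hy => by
    rw [hGdef, indicator_of_mem (hW't hy), hF, M.transition_symm]
  set A := M.chart α '' B with hA
  have hAm : MeasurableSet A := by
    rw [hA, (M.chart α).image_eq_target_inter_inv_preimage (hBα.trans inter_subset_left)]
    exact (M.chart α).continuousOn_symm.measurableSet_inter_preimage_of_measurableSet
      (M.chart α).open_target.measurableSet hB
  have hAW : A ⊆ W := image_mono fun x hx => ⟨(hBα hx).1, (hBβ hx).1, (hBα hx).2⟩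
  have hGA : G ⁻¹' A ∩ W' = M.chart β '' B := by
    ext y
    constructor
    · rintro ⟨hy, hy'⟩
      rw [mem_preimage, hGW y hy'] at hy
      obtain ⟨b, hb, hby⟩ := hy
      refine ⟨b, hb, ?_⟩
      have hys := overlap_subset_source β α Ω hy'
      have h1 := symm_transition_apply hys
      rw [← hby, (M.chart α).left_inv (hBα hb).1] at h1
      rw [h1, (M.chart β).right_inv (M.mem_overlap.1 hy').1]
    · rintro ⟨b, hb, rfl⟩
      have hy' : M.chart β b ∈ W' := ⟨b, ⟨(hBβ hb).1, (hBα hb).1, (hBβ hb).2⟩, rfl⟩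
      refine ⟨?_, hy'⟩
      rw [mem_preimage, hGW _ hy', M.transition_apply, (M.chart β).left_inv (hBβ hb).1]
      exact ⟨b, hb, rfl⟩
  set m := ((S.localNorm β E').restrict W').withDensity
    fun y => ENNReal.ofReal (absJacSymm F y) with hm
  have hmap : m.map G = (S.localNorm α E).restrict W := by
    rw [← pullbackPos_localNorm hΩ hE hE', pullbackPos]
    refine Measure.map_congr ?_
    have : ∀ᵐ y ∂m, y ∈ W' := withDensity_absolutelyContinuous _ _
      (show (S.localNorm β E').restrict W' W'ᶜ = 0 by
        rw [Measure.restrict_apply hW'o.measurableSet.compl]; simp)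
    filter_upwards [this] with y hy
    rw [hGdef, indicator_of_mem (hW't hy)]
  have hres : (S.localNorm α E).restrict A = (m.restrict (G ⁻¹' A)).map G := by
    rw [← Measure.restrict_restrict_of_subset hAW, ← hmap, Measure.restrict_map hG hAm]
  have hres' : m.restrict (G ⁻¹' A) = ((S.localNorm β E').restrict (M.chart β '' B)).withDensity
      fun y => ENNReal.ofReal (absJacSymm F y) := by
    rw [hm, restrict_withDensity (hG hAm), Measure.restrict_restrict (hG hAm), hGA]
  have hmα : AEMeasurable (fun x => ENNReal.ofReal (M.sqrtDetG α x))
      ((m.restrict (G ⁻¹' A)).map G) := by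
    rw [← hres]
    exact (hμα.aestronglyMeasurable (isOpen_img α hΩ)
      (isCw0_sqrtDetG_img hΩ α)).aemeasurable.ennreal_ofReal.restrict
  have hBW' : M.chart β '' B ⊆ W' := hGA ▸ inter_subset_right
  have hJm : AEMeasurable (fun y => ENNReal.ofReal (absJacSymm F y))
      ((S.localNorm β E').restrict (M.chart β '' B)) := by
    have hJ := ((isCw0_absJacSymm (M := M) α β).mono hW'o (overlap_subset_source β α Ω))
    refine (hJ.aestronglyMeasurable hW'o.measurableSet ?_ ?_).aemeasurable.ennreal_ofReal
    · rw [Measure.restrict_apply hW'o.measurableSet.compl]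
      exact measure_mono_null (fun y hy => hy.1 (hBW' hy.2)) measure_empty
    · exact Measure.absolutelyContinuous_of_le Measure.restrict_le_self
        (hμβ.null (M.sing_null β))
  rw [hres, lintegral_map' hmα hG.aemeasurable]
  have hmG : AEMeasurable (fun y => ENNReal.ofReal (M.sqrtDetG α (G y))) (m.restrict (G ⁻¹' A)) :=
    hmα.comp_measurable hG
  rw [hres'] at hmG ⊢
  rw [lintegral_withDensity_eq_lintegral_mul₀' hJm hmG]
  refine lintegral_congr_ae ?_
  have h1 : ∀ᵐ y ∂(S.localNorm β E').restrict (M.chart β '' B), y ∈ M.chart β '' B := by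
    refine ae_restrict_mem ?_
    rw [← hGA]
    exact (hG hAm).inter hW'o.measurableSet
  have h2 : ∀ᵐ y ∂(S.localNorm β E').restrict (M.chart β '' B), y ∉ M.img β M.sing := by
    refine ae_restrict_of_ae ?_
    rw [ae_iff]
    have : (S.localNorm β E') (M.img β M.sing) = 0 := hμβ.null (M.sing_null β)
    simpa using this
  filter_upwards [h1, h2] with y hy hys
  rw [Pi.mul_apply, hGW y (hBW' hy),
    sqrtDetG_transition (overlap_subset_source β α Ω (hBW' hy)) hys,
    ENNReal.ofReal_mul (show 0 ≤ absJacSymm (M.transition α β) y from abs_nonneg _)]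

/-- A measure on `Ω` that is given in every chart by a measure of class `GM` is of class `GM`. -/
theorem isPosGM_of_forall_chart [MeasurableSpace X] [BorelSpace X] (hΩ : IsOpen Ω) {ν : Measure X}
    (hν : ν Ωᶜ = 0) {κ : Λ → Measure (Euc N)} (hκ : ∀ α, _root_.IsPosGM (M.img α Ω) (κ α))
    (h : ∀ α B, MeasurableSet B → B ⊆ (M.chart α).source ∩ Ω → ν B = κ α (M.chart α '' B)) :
    M.IsPosGM Ω ν := by
  have hUo : ∀ α, IsOpen ((M.chart α).source ∩ Ω) := fun α => (M.chart α).open_source.inter hΩ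
  have hcont : ∀ α, ContinuousOn (M.chart α) ((M.chart α).source ∩ Ω) := fun α =>
    (M.chart α).continuousOn.mono inter_subset_left
  have hae : ∀ α, AEMeasurable (M.chart α) (ν.restrict ((M.chart α).source ∩ Ω)) := fun α =>
    (hcont α).aemeasurable (hUo α).measurableSet
  have hread : ∀ α, (ν.restrict ((M.chart α).source ∩ Ω)).map (M.chart α) = κ α := fun α => by
    ext B hB
    have hm := (hcont α).measurableSet_inter_preimage_of_measurableSet (hUo α).measurableSet hB
    rw [Measure.map_apply_of_aemeasurable (hae α) hB,
      Measure.restrict_apply' (hUo α).measurableSet, inter_comm, h α _ hm inter_subset_left,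
      image_inter_preimage]
    have hc : ∀ᵐ x ∂κ α, x ∈ M.img α Ω := (hκ α).conc
    refine measure_congr ?_
    filter_upwards [hc] with x hx
    exact propext ⟨fun hx' => hx'.2, fun hx' => ⟨hx, hx'⟩⟩
  refine ⟨fun K hK hKΩ => ?_, hν, fun α => hread α ▸ hκ α⟩
  -- Local finiteness suffices on a compact set: a small closed ball read in a chart around `x` is a
  -- neighbourhood of finite measure.
  refine hK.measure_lt_top_of_nhdsWithin fun x hx => ?_
  obtain ⟨α, hα⟩ := M.cover x
  have hxi : M.chart α x ∈ M.img α Ω := ⟨x, ⟨hα, hKΩ hx⟩, rfl⟩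
  obtain ⟨r, hr, hrs⟩ :=
    Metric.nhds_basis_closedBall.mem_iff.1 ((isOpen_img α hΩ).mem_nhds hxi)
  refine ⟨M.chart α ⁻¹' Metric.closedBall (M.chart α x) r ∩ ((M.chart α).source ∩ Ω),
    mem_nhdsWithin_of_mem_nhds (Filter.inter_mem ?_ ((hUo α).mem_nhds ⟨hα, hKΩ hx⟩)), ?_⟩
  · exact ((M.chart α).continuousAt hα).preimage_mem_nhds (Metric.closedBall_mem_nhds _ hr)
  · rw [← Measure.restrict_apply' (hUo α).measurableSet,
      ← Measure.map_apply_of_aemeasurable (hae α) Metric.isClosed_closedBall.measurableSet, hread]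
    exact (hκ α).finite _ (isCompact_closedBall _ _) hrs

/-- A σ-compact space is Lindelöf. Countability is what permits gluing by a sum, and later comparing
measures chart by chart. -/
theorem exists_countable_cover (M : DC0Manifold N X Λ) :
    ∃ t : Set Λ, t.Countable ∧ ⋃ α ∈ t, (M.chart α).source = univ := by
  obtain ⟨t, ht, h⟩ := (isLindelof_univ (X := X)).elim_countable_subcover
    (fun α => (M.chart α).source) (fun α => (M.chart α).open_source)
    fun x _ => mem_iUnion.2 (M.cover x)
  exact ⟨t, ht, univ_subset_iff.1 h⟩

theorem GMTensor.existsUnique_measure [MeasurableSpace X] [BorelSpace X] (hΩ : IsOpen Ω)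
    (S : M.GMTensor Ω p) :
    ∃! ν : Measure X, M.IsPosGM Ω ν ∧
      ∀ α E, M.IsFrame Ω α E → ∀ B, MeasurableSet B → B ⊆ (M.chart α).source ∩ Ω →
        ν B = ∫⁻ x in M.chart α '' B, ENNReal.ofReal (M.sqrtDetG α x) ∂(S.localNorm α E) := by
  choose E hE using fun α => exists_isFrame (M := M) hΩ α
  obtain ⟨t, ht, htU⟩ := M.exists_countable_cover
  let κ : Λ → Measure (Euc N) := fun α =>
    (S.localNorm α (E α)).withDensity fun x => ENNReal.ofReal (M.sqrtDetG α x)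
  have hκ : ∀ α, _root_.IsPosGM (M.img α Ω) (κ α) := fun α =>
    (isPosGM_localNorm hΩ (hE α)).withDensity (isCw0_sqrtDetG_img hΩ α)
  have hUo : ∀ α, IsOpen ((M.chart α).source ∩ Ω) := fun α => (M.chart α).open_source.inter hΩ
  have himg : ∀ α B, MeasurableSet B → B ⊆ (M.chart α).source ∩ Ω →
      MeasurableSet (M.chart α '' B) := fun α B hB hBα => by
    rw [(M.chart α).image_eq_target_inter_inv_preimage (hBα.trans inter_subset_left)]
    exact (M.chart α).continuousOn_symm.measurableSet_inter_preimage_of_measurableSet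
      (M.chart α).open_target.measurableSet hB
  have hκB : ∀ α B, MeasurableSet B → B ⊆ (M.chart α).source ∩ Ω → κ α (M.chart α '' B) =
      ∫⁻ x in M.chart α '' B, ENNReal.ofReal (M.sqrtDetG α x) ∂(S.localNorm α (E α)) :=
    fun α B hB hBα => withDensity_apply _ (himg α B hB hBα)
  have hmapB : ∀ α B, MeasurableSet B → B ⊆ (M.chart α).source ∩ Ω →
      (κ α).map (M.chart α).symm B = κ α (M.chart α '' B) := fun α B hB hBα => by
    have hc : ∀ᵐ x ∂κ α, x ∈ (M.chart α).target :=
      measure_mono_null (compl_subset_compl.2 (img_subset_target α Ω)) (hκ α).conc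
    have hae : AEMeasurable (M.chart α).symm (κ α) := by
      rw [← Measure.restrict_eq_self_of_ae_mem hc]
      exact (M.chart α).continuousOn_symm.aemeasurable (M.chart α).open_target.measurableSet
    rw [Measure.map_apply_of_aemeasurable hae hB,
      (M.chart α).image_eq_target_inter_inv_preimage (hBα.trans inter_subset_left)]
    refine measure_congr ?_
    filter_upwards [hc] with x hx
    exact propext ⟨fun hx' => ⟨hx, hx'⟩, fun hx' => hx'.2⟩
  have hUΩ : ⋃ α ∈ t, (M.chart α).source ∩ Ω = Ω := by
    rw [← iUnion₂_inter, htU, univ_inter]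
  obtain ⟨ν, hν, hν0⟩ := Measure.exists_glue (fun α => (hUo α).measurableSet) t ht
    (fun α => hUΩ.symm ▸ inter_subset_right) (fun α => (κ α).map (M.chart α).symm)
    fun α β B hB hBU => by
      have h1 := hBU.trans inter_subset_left
      have h2 := hBU.trans inter_subset_right
      rw [hmapB α B hB h1, hmapB β B hB h2, hκB α B hB h1, hκB β B hB h2,
        setLIntegral_sqrtDetG_eq hΩ (hE α) (hE β) hB h1 h2]
  have hνB : ∀ α B, MeasurableSet B → B ⊆ (M.chart α).source ∩ Ω →
      ν B = κ α (M.chart α '' B) := fun α B hB hBα => by rw [hν α B hB hBα, hmapB α B hB hBα]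
  have hνc : ν Ωᶜ = 0 := by
    refine measure_mono_null (compl_subset_compl.2 ?_) hν0
    exact iUnion_subset fun α => inter_subset_right
  refine ⟨ν, ⟨isPosGM_of_forall_chart hΩ hνc hκ hνB, fun α E' hE' B hB hBα => ?_⟩, ?_⟩
  -- The gluing used one chosen frame per chart; comparing the chart with itself allows any other
  -- frame.
  · rw [hνB α B hB hBα, hκB α B hB hBα, setLIntegral_sqrtDetG_eq hΩ (hE α) hE' hB hBα hBα]
  · rintro ν' ⟨hν', hν'B⟩
    rw [← Measure.restrict_eq_self_of_ae_mem (show ∀ᵐ x ∂ν', x ∈ Ω from hν'.conc),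
      ← Measure.restrict_eq_self_of_ae_mem (show ∀ᵐ x ∂ν, x ∈ Ω from hνc), ← hUΩ,
      Measure.restrict_biUnion_congr ht]
    intro α _
    ext B hB
    have hBm := hB.inter (hUo α).measurableSet
    rw [Measure.restrict_apply hB, Measure.restrict_apply hB,
      hν'B α (E α) (hE α) _ hBm inter_subset_right, hνB α _ hBm inter_subset_right,
      hκB α _ hBm inter_subset_right]

end DC0Manifold

theorem lemma4p11 {N : ℕ} (hN : 1 ≤ N) {X : Type*} [TopologicalSpace X] [T2Space X]
    [SigmaCompactSpace X] [MeasurableSpace X] [BorelSpace X] {Λ : Type*}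
    (M : DC0Manifold N X Λ) (Ω : Set X) (hΩ : IsOpen Ω) (p : ℕ) (S : M.GMTensor Ω p) :
    (∀ α, ∃ E, M.IsFrame Ω α E) ∧
    (∀ α E, M.IsFrame Ω α E → IsPosGM (M.img α Ω) (S.localNorm α E)) ∧
    (∀ α β E E', M.IsFrame Ω α E → M.IsFrame Ω β E' →
      pullbackPos (M.transition α β) (M.overlap β α Ω) (S.localNorm β E') =
        (S.localNorm α E).restrict (M.overlap α β Ω)) ∧
    ∃! ν : Measure X, M.IsPosGM Ω ν ∧
      ∀ α E, M.IsFrame Ω α E → ∀ B, MeasurableSet B → B ⊆ (M.chart α).source ∩ Ω →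
        ν B = ∫⁻ x in M.chart α '' B, ENNReal.ofReal (M.sqrtDetG α x) ∂(S.localNorm α E) :=
  ⟨fun α => DC0Manifold.exists_isFrame hΩ α,
    fun _ _ hE => DC0Manifold.GMTensor.isPosGM_localNorm hΩ hE,
    fun _ _ _ _ hE hE' => DC0Manifold.GMTensor.pullbackPos_localNorm hΩ hE hE',
    S.existsUnique_measure hΩ⟩
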